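/- Let $A$ be a finite-dimensional real alternative (not necessarily associative) algebra with unity $1\neq 0$, equipped with a real linear anti-involution $x\mapsto x^c$ and with its natural Euclidean topology and real analytic structure as a finite-dimensional real vector space. Assume that $\mathbb{S}_A:=\{J\in A : J+J^c=0,\ JJ^c=1\}$ is non-empty. Let $n\geq 1$, let $\{e_K\}_K$ be a basis of $\mathbb{R}^{2^n}$ indexed by the subsets $K$ of $\{1,\dots,n\}$, and let $D\subseteq\mathbb{C}^n$ be non-empty and invariant under conjugation $z\mapsto \overline{z}^h$ of each single coordinate $z_h$. A function $F=\sum_K e_KF_K: D\to A\otimes\mathbb{R}^{2^n}$, with components $F_K:D\to A$, is a stem function if, for all $z\in D$, all $K$ and all $h$, $F_K(\overline{z}^h)=F_K(z)$ if $h\notin K$ and $F_K(\overline{z}^h)=-F_K(z)$ if $h\in K$. Let $\Omega_D\subseteq A^n$ be the set of all $(\alpha_1+J_1\beta_1,\dots,\alpha_n+J_n\beta_n)$ with $J_h\in\mathbb{S}_A$, $\alpha_h,\beta_h\in\mathbb{R}$ and $(\alpha_1+i\beta_1,\dots,\alpha_n+i\beta_n)\in D$. A stem function $F$ induces the slice function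 $f:\Omega_D\to A$ given by $$f(\alpha_1+J_1\beta_1,\dots,\alpha_n+J_n\beta_n)=\sum_{K}[J_K,F_K(\alpha_1+i\beta_1,\dots,\alpha_n+i\beta_n)],$$ where $[J_K,v]:=J_{k_1}(J_{k_2}(\cdots(J_{k_p}v)\cdots))$ for $K=\{k_1<\dots<k_p\}$ and $[J_\emptyset,v]:=v$. For a subset $S$ of a finite-dimensional real vector space, a map $S\to A$ is of class $\mathscr{C}^0$ if it is continuous for the relative topology of $S$; for $r\in\{1,2,\dots\}\cup\{\infty,\omega\}$ it is of class $\mathscr{C}^r$ if it is the restriction of a $\mathscr{C}^r$ map defined on an open neighbourhood of $S$ ($\mathscr{C}^\omega$ means real analytic). Let $\mathcal{S}^r(\Omega_D,A)$ be the set of slice functions on $\Omega_D$ induced by stem functions $F$ all of whose components $F_K:D\to A$ are of class $\mathscr{C}^r$ (here $D$ is assumed to be open if $r\neq 0$), and let $\mathscr{C}^r(\Omega_D,A)$ be the set of maps $\Omega_D\to A$ of class $\mathscr{C}^r$. Then: (i) If $\mathbb{S}_A$ is compact, then $\mathcal{S}^0(\Omega_D,A)\subseteq\mathscr{C}^0(\Omega_D,A)$.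 (ii) If $D$ is open in $\mathbb{C}^n$ and $r\in\mathbb{N}$ satisfies $r\geq 2^n-1$, then $\mathcal{S}^r(\Omega_D,A)\subseteq\mathscr{C}^{w}(\Omega_D,A)$ with $w=\left\lfloor\frac{r+1}{2^n}\right\rfloor-1$. (iii) If $D$ is open in $\mathbb{C}^n$, then $\mathcal{S}^\infty(\Omega_D,A)\subseteq\mathscr{C}^\infty(\Omega_D,A)$ and $\mathcal{S}^\omega(\Omega_D,A)\subseteq\mathscr{C}^\omega(\Omega_D,A)$. -/

import Mathlib

open scoped ContDiff TensorProduct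

namespace SliceFunctions

/-- A unital ring, not necessarily associative, with a norm on its additive group. The norm need not
be compatible with the product: its only role is to provide, on a finite dimensional real algebra,
the Euclidean topology and the notion of a map of class `C^r`. -/
class NormedNonAssocRing (A : Type*) extends NormedAddCommGroup A, NonAssocRing A

/-- The algebra is alternative: `x²y = x(xy)` and `(yx)x = yx²`. -/
def IsAlternative (A : Type*) [Mul A] : Prop :=
  ∀ x y : A, (x * x) * y = x * (x * y) ∧ (y * x) * x = y * (x * x)

/-- The sphere `𝕊_A` of the imaginary units `J`, with trace `J + J^c = 0` and norm `J J^c = 1`. -/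
def imaginaryUnits (A : Type*) [NonAssocRing A] [Star A] : Set A :=
  {J | J + star J = 0 ∧ J * star J = 1}

/-- The notion of a map of class `C^r` on an arbitrary subset `S` of a normed space `X`: for `r = 0` it is a
continuous map on `S` with its relative topology, for `r ≥ 1` it is the restriction of a map of
class `C^r` defined on an open neighbourhood of `S`. Here `r` ranges over `ℕ ∪ {∞, ω}`. -/
def IsOfClass {X Y : Type*} [NormedAddCommGroup X] [NormedSpace ℝ X] [NormedAddCommGroup Y]
    [NormedSpace ℝ Y] (r : WithTop ℕ∞) {S : Set X} (f : S → Y) : Prop :=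
  (r = 0 → Continuous f) ∧
  (r ≠ 0 → ∃ (U : Set X) (g : X → Y), IsOpen U ∧ S ⊆ U ∧ ContDiffOn ℝ r g U ∧ ∀ x : S, g x = f x)

section Stem

variable {n : ℕ}

/-- Conjugation of the `h`-th coordinate of a point of `ℂⁿ`. -/
def conjAt (h : Fin n) (z : Fin n → ℂ) : Fin n → ℂ :=
  Function.update z h (starRingEnd ℂ (z h))

/-- `D ⊆ ℂⁿ` is invariant under complex conjugations. -/
def IsConjInvariant (D : Set (Fin n → ℂ)) : Prop :=
  ∀ z ∈ D, ∀ h : Fin n, conjAt h z ∈ D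

variable {A : Type*} [NormedNonAssocRing A] [NormedSpace ℝ A]

/-- The `K`-component `F_K : D → A` of `F = ∑_K e_K F_K : D → A ⊗ ℝ^(2^n)`, with respect to a basis
`(e_K)` of `ℝ^(2^n)` indexed by the subsets `K` of `{1, …, n}`. -/
noncomputable def component (e : Module.Basis (Finset (Fin n)) ℝ (Fin (2 ^ n) → ℝ))
    {D : Set (Fin n → ℂ)} (F : D → A ⊗[ℝ] (Fin (2 ^ n) → ℝ)) (K : Finset (Fin n)) (z : D) : A :=
  TensorProduct.rid ℝ A ((e.coord K).lTensor A (F z))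

/-- `F` is a stem function: each `F_K` is even in `z_h` for `h ∉ K` and odd for `h ∈ K`, with respect
to the conjugation of `z_h`. -/
def IsStem (e : Module.Basis (Finset (Fin n)) ℝ (Fin (2 ^ n) → ℝ)) {D : Set (Fin n → ℂ)}
    (F : D → A ⊗[ℝ] (Fin (2 ^ n) → ℝ)) : Prop :=
  ∀ (K : Finset (Fin n)) (h : Fin n) (z w : D), (w : Fin n → ℂ) = conjAt h z →
    (h ∉ K → component e F K w = component e F K z) ∧
    (h ∈ K → component e F K w = -component e F K z)

/-- The ordered product `[u_K, v] = u_{k₁}(u_{k₂}(⋯(u_{k_p} v)⋯))` for `K = {k₁ < ⋯ < k_p}`. -/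
def orderedProduct (u : Fin n → A) (K : Finset (Fin n)) (v : A) : A :=
  (K.sort (· ≤ ·)).foldr (fun k a => u k * a) v

/-- `x = (α₁ + J₁ β₁, …, αₙ + Jₙ βₙ)` with `z = (α₁ + i β₁, …, αₙ + i βₙ)` and all `J_h ∈ 𝕊_A`. -/
def Represents [Star A] (z : Fin n → ℂ) (J : Fin n → A) (x : Fin n → A) : Prop :=
  (∀ h, J h ∈ imaginaryUnits A) ∧ ∀ h, x h = (z h).re • (1 : A) + (z h).im • J h

/-- The circularization `Ω_D ⊆ Aⁿ` of `D ⊆ ℂⁿ`. -/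
def circularization (A : Type*) [NormedNonAssocRing A] [NormedSpace ℝ A] [Star A]
    (D : Set (Fin n → ℂ)) : Set (Fin n → A) :=
  {x | ∃ z ∈ D, ∃ J : Fin n → A, Represents z J x}

/-- `f = 𝓘(F)`: the function `f : Ω_D → A` is induced by `F`, that is `f(x) = ∑_K [J_K, F_K(z)]`
for every representation of `x ∈ Ω_D` through `z ∈ D` and imaginary units `J`. -/
def Induces [Star A] (e : Module.Basis (Finset (Fin n)) ℝ (Fin (2 ^ n) → ℝ)) {D : Set (Fin n → ℂ)}
    (F : D → A ⊗[ℝ] (Fin (2 ^ n) → ℝ)) (f : circularization A D → A) : Prop :=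
  ∀ (x : circularization A D) (z : D) (J : Fin n → A), Represents z J (x : Fin n → A) →
    f x = ∑ K : Finset (Fin n), orderedProduct J K (component e F K z)

/-- `𝓢^r(Ω_D, A)`: the slice functions `Ω_D → A` induced by stem functions all of whose components
are of class `C^r`. -/
def sliceClass (A : Type*) [NormedNonAssocRing A] [NormedSpace ℝ A] [Star A]
    (e : Module.Basis (Finset (Fin n)) ℝ (Fin (2 ^ n) → ℝ)) (D : Set (Fin n → ℂ))
    (r : WithTop ℕ∞) : Set (circularization A D → A) :=
  {f | ∃ F : D → A ⊗[ℝ] (Fin (2 ^ n) → ℝ),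
    IsStem e F ∧ (∀ K, IsOfClass r (component e F K)) ∧ Induces e F f}

end Stem

end SliceFunctions

/-!
Write `z²` for the point of `ℂⁿ` obtained from `z` by squaring the imaginary parts of all coordinates
(`sqOn Finset.univ z`). If the component `F_K` of a stem function can be written as
`F_K(z) = (∏_{k ∈ K} Im z_k) G_K(z²)`, then for `x_h = α_h + J_h β_h` the summand `[J_K, F_K(z)]`
equals `[(β J)_K, G_K(z²)]`. Here `α_h`, `β_h J_h = x_h - α_h` and `z²` are polynomial functions of
`x`, since `x_h + x_h^c = 2 α_h` and `x_h x_h^c = α_h² + β_h²`. The right hand side therefore makes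
sense near `Ω_D` and is as regular as `G_K` (`sliceExtension_eq`, `contDiffAt_sliceExtension`).
What is needed is Whitney's theorem on even and odd functions, in several variables and with an
extension of `G_K` to negative values of the squares.

*Finite and infinite differentiability.* One variable at a time, an odd function is first divided by
the variable, with the loss of one derivative (`hadamardQuotient`). An even function `H(y, b)` of
class `C^{2s}` is `G(y, b²)` where `G(y, u) = H(y, √u)` for `u ≥ 0`. For `u < 0` one sets
`G(y, u) = ∫ κ(t) H(y, t √-u) dt` with a weight `κ` whose moments satisfy `∫ t^{2j} κ = (-1)^j`
(`exists_isReflectionWeight`, by Fourier inversion). The derivative of `G` in `u` is of the same form,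
with `H` replaced by `∂_b H / 2b` and `κ` by `-t² κ`, and the moments make both
formulas match at `u = 0`, so that `G` is of class `C^s` by induction (`contDiff_fold`). The same `G`
serves all `s`. Each variable turns `r + 1` into `⌊(r + 1) / 2⌋` (`exists_contDiff_sqOn`).
The construction is applied after multiplying `F_K` by a cutoff depending on `z²` only, and the local
extensions are glued with a partition of unity (`isOfClass_of_local`).

*Analyticity.* Near a point with `b = 0` the even and odd powers of `b` in the power series of `H` are
separated (`exists_analyticAt_even_odd`), and elsewhere the square root is analytic. The germs of `G_K`
obtained at the various points are glued by the identity theorem (`exists_analyticOnNhd_of_germs`).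

*Continuity.* When `𝕊_A` is compact, the representative `z` of `x` with nonnegative imaginary parts
depends continuously on `x`, and limits of the imaginary units along ultrafilters exist
(`continuous_of_mem_sliceClass`).
-/

/-! ### Averages over dilations and reflection of even functions -/

namespace SliceFunctions

open MeasureTheory Filter Topology Set
open scoped ContDiff

section Moment

variable {E F : Type*} [NormedAddCommGroup E] [NormedSpace ℝ E]
  [NormedAddCommGroup F] [NormedSpace ℝ F]

/-- All moments of the weight `w` are absolutely convergent. -/
def HasMoments (w : ℝ → ℝ) : Prop := ∀ j : ℕ, Integrable fun t => t ^ j * w t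

/-- `H(y, b)` vanishes for `|b| > R`, where `R` does not depend on `y`. -/
def BoundedSupp (H : E × ℝ → F) : Prop := ∃ R : ℝ, ∀ p, R < |p.2| → H p = 0

/-- The average `∫ w(t) H(y, t b) dt` of `H` over dilations of its real variable. -/
noncomputable def dilationAverage (w : ℝ → ℝ) (H : E × ℝ → F) (p : E × ℝ) : F :=
  ∫ t, w t • H (p.1, t * p.2)

theorem HasMoments.integrable {w : ℝ → ℝ} (hw : HasMoments w) : Integrable w := by
  simpa using hw 0

theorem HasMoments.pow_mul {w : ℝ → ℝ} (hw : HasMoments w) (m : ℕ) :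
    HasMoments fun t => t ^ m * w t := by
  intro j
  have := hw (j + m)
  simpa only [pow_add, mul_assoc] using this

theorem BoundedSupp.fderiv {H : E × ℝ → F} (h : BoundedSupp H) :
    BoundedSupp (fderiv ℝ H) := by
  obtain ⟨R, hR⟩ := h
  refine ⟨R, fun p hp => ?_⟩
  have : H =ᶠ[𝓝 p] fun _ => 0 := by
    have ho : IsOpen {q : E × ℝ | R < |q.2|} :=
      isOpen_lt continuous_const (continuous_abs.comp continuous_snd)
    filter_upwards [ho.mem_nhds hp] with q hq using hR q hq
  rw [this.fderiv_eq]
  simp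

theorem BoundedSupp.clm_comp {E F G : Type*} [NormedAddCommGroup F] [NormedSpace ℝ F]
    [NormedAddCommGroup G] [NormedSpace ℝ G] {H : E × ℝ → F} (h : BoundedSupp H) (L : F →L[ℝ] G) :
    BoundedSupp fun p => L (H p) := by
  obtain ⟨R, hR⟩ := h
  exact ⟨R, fun p hp => by simp [hR p hp]⟩

theorem BoundedSupp.exists_bound {F : Type*} [NormedAddCommGroup F] [FiniteDimensional ℝ E]
    {H : E × ℝ → F} (h : BoundedSupp H)
    (hc : Continuous H) (y₀ : E) :
    ∃ C, 0 ≤ C ∧ ∀ y ∈ Metric.ball y₀ 1, ∀ b, ‖H (y, b)‖ ≤ C := by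
  obtain ⟨R, hR⟩ := h
  have := FiniteDimensional.proper_real E
  have hK : IsCompact (Metric.closedBall y₀ 1 ×ˢ Icc (-R) R) :=
    (isCompact_closedBall _ _).prod isCompact_Icc
  obtain ⟨C, hC⟩ := hK.exists_bound_of_continuousOn hc.continuousOn
  refine ⟨max C 0, le_max_right _ _, fun y hy b => ?_⟩
  by_cases hb : R < |b|
  · rw [hR (y, b) hb]; simp
  · exact (hC (y, b) ⟨Metric.ball_subset_closedBall hy, abs_le.1 (not_lt.1 hb)⟩).trans
      (le_max_left _ _)

variable [FiniteDimensional ℝ E]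

theorem integrable_dilation {w : ℝ → ℝ} (hw : HasMoments w) {H : E × ℝ → F}
    (hs : BoundedSupp H) (hc : Continuous H) (p : E × ℝ) :
    Integrable fun t => w t • H (p.1, t * p.2) := by
  obtain ⟨C, -, hC⟩ := hs.exists_bound hc p.1
  refine (hw.integrable.norm.mul_const C).mono'
    (hw.integrable.aestronglyMeasurable.smul (by fun_prop)) (ae_of_all _ fun t => ?_)
  rw [norm_smul]
  gcongr
  exact hC _ (Metric.mem_ball_self one_pos) _

theorem continuous_dilationAverage {w : ℝ → ℝ} (hw : HasMoments w) {H : E × ℝ → F}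
    (hs : BoundedSupp H) (hc : Continuous H) : Continuous (dilationAverage w H) := by
  refine continuous_iff_continuousAt.2 fun p => ?_
  obtain ⟨C, -, hC⟩ := hs.exists_bound hc p.1
  refine continuousAt_of_dominated (bound := fun t => ‖w t‖ * C)
    (Eventually.of_forall fun q =>
      hw.integrable.aestronglyMeasurable.smul (by fun_prop)) ?_
    (hw.integrable.norm.mul_const C) (ae_of_all _ fun t => by fun_prop)
  have : ∀ᶠ q : E × ℝ in 𝓝 p, q.1 ∈ Metric.ball p.1 1 :=
    continuous_fst.continuousAt.eventually (Metric.ball_mem_nhds _ one_pos)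
  filter_upwards [this] with q hq
  refine ae_of_all _ fun t => ?_
  rw [norm_smul]
  gcongr
  exact hC _ hq _

/-- Differentiation under the integral sign. -/
theorem hasFDerivAt_dilationAverage [CompleteSpace F] {w : ℝ → ℝ} (hw : HasMoments w) {H : E × ℝ → F}
    (hs : BoundedSupp H) (hc : ContDiff ℝ 1 H) (p : E × ℝ) :
    HasFDerivAt (dilationAverage w H)
      ((dilationAverage w (fun q => (fderiv ℝ H q).comp (ContinuousLinearMap.inl ℝ E ℝ)) p).coprod
        (ContinuousLinearMap.toSpanSingleton ℝ
          (dilationAverage (fun t => t ^ 1 * w t) (fun q => fderiv ℝ H q (0, 1)) p))) p := by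
  have hc' : Continuous (fderiv ℝ H) := hc.continuous_fderiv one_ne_zero
  obtain ⟨C, hC0, hC⟩ := hs.fderiv.exists_bound hc' p.1
  let Λ : ℝ → E × ℝ →L[ℝ] E × ℝ := fun t =>
    (ContinuousLinearMap.fst ℝ E ℝ).prod (t • ContinuousLinearMap.snd ℝ E ℝ)
  have hΛ : Continuous Λ := by
    have : Λ = fun t => (ContinuousLinearMap.inl ℝ E ℝ).comp (ContinuousLinearMap.fst ℝ E ℝ) +
        t • (ContinuousLinearMap.inr ℝ E ℝ).comp (ContinuousLinearMap.snd ℝ E ℝ) := by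
      funext t; ext <;> simp [Λ]
    rw [this]; fun_prop
  have hΛn : ∀ t, ‖Λ t‖ ≤ 1 + |t| := fun t =>
    ContinuousLinearMap.opNorm_le_bound _ (by positivity) fun x => by
      refine max_le ?_ ?_
      · have := norm_fst_le x
        change ‖x.1‖ ≤ _
        nlinarith [abs_nonneg t, norm_nonneg x]
      · have := norm_snd_le x
        change ‖t * x.2‖ ≤ _
        rw [norm_mul, Real.norm_eq_abs]
        nlinarith [abs_nonneg t, norm_nonneg x, mul_le_mul_of_nonneg_left this (abs_nonneg t)]
  have hint : ∀ q : E × ℝ, AEStronglyMeasurable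
      (fun t => w t • (fderiv ℝ H (q.1, t * q.2)).comp (Λ t)) volume := fun q =>
    hw.integrable.aestronglyMeasurable.smul
      (Continuous.aestronglyMeasurable (by fun_prop))
  have hbd : Integrable fun t => ‖w t‖ * (C * (1 + |t|)) := by
    have h1 := (hw.integrable.norm.add (hw 1).norm).const_mul C
    refine h1.congr (ae_of_all _ fun t => ?_)
    simp; ring
  have hle : ∀ q ∈ Metric.ball p 1, ∀ t,
      ‖w t • (fderiv ℝ H (q.1, t * q.2)).comp (Λ t)‖ ≤ ‖w t‖ * (C * (1 + |t|)) := by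
    intro q hq t
    rw [norm_smul]
    gcongr
    refine (ContinuousLinearMap.opNorm_comp_le _ _).trans ?_
    gcongr
    · refine hC _ ?_ _
      rw [Metric.mem_ball, Prod.dist_eq] at hq
      exact (le_max_left _ _).trans_lt hq
    · exact hΛn t
  have key := hasFDerivAt_integral_of_dominated_of_fderiv_le (μ := volume) (𝕜 := ℝ)
    (F := fun q t => w t • H (q.1, t * q.2))
    (F' := fun q t => w t • (fderiv ℝ H (q.1, t * q.2)).comp (Λ t)) (x₀ := p)
    (bound := fun t => ‖w t‖ * (C * (1 + |t|))) (Metric.ball_mem_nhds p one_pos)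
    (Eventually.of_forall fun q => (integrable_dilation hw hs hc.continuous q).1)
    (integrable_dilation hw hs hc.continuous p) (hint p)
    (ae_of_all _ fun t q hq => hle q hq t) hbd
    (ae_of_all _ fun t q _ => by
      have h1 : HasFDerivAt (fun q : E × ℝ => (q.1, t * q.2)) (Λ t) q := (Λ t).hasFDerivAt
      exact ((hc.differentiable one_ne_zero (q.1, t * q.2)).hasFDerivAt.comp q h1).const_smul (w t))
  refine key.congr_fderiv ?_
  have hI : Integrable fun t => w t • (fderiv ℝ H (p.1, t * p.2)).comp (Λ t) :=
    hbd.mono' (hint p) (ae_of_all _ fun t => hle p (Metric.mem_ball_self one_pos) t)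
  have hcy : Continuous fun q => (fderiv ℝ H q).comp (ContinuousLinearMap.inl ℝ E ℝ) := by fun_prop
  have hsy : BoundedSupp fun q => (fderiv ℝ H q).comp (ContinuousLinearMap.inl ℝ E ℝ) :=
    hs.fderiv.clm_comp (ContinuousLinearMap.precomp F (ContinuousLinearMap.inl ℝ E ℝ))
  ext v
  · rw [ContinuousLinearMap.coe_comp, Function.comp_apply,
      ContinuousLinearMap.integral_apply hI]
    simp only [dilationAverage, ContinuousLinearMap.comp_apply, ContinuousLinearMap.coprod_apply,
      ContinuousLinearMap.inl_apply, map_zero, add_zero]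
    rw [ContinuousLinearMap.integral_apply (integrable_dilation hw hsy hcy p)]
    simp [Λ]
  · rw [ContinuousLinearMap.coe_comp, Function.comp_apply,
      ContinuousLinearMap.integral_apply hI]
    simp only [dilationAverage, ContinuousLinearMap.comp_apply, ContinuousLinearMap.coprod_apply,
      ContinuousLinearMap.inr_apply, map_zero, zero_add,
      ContinuousLinearMap.toSpanSingleton_apply, one_smul]
    refine integral_congr_ae (ae_of_all _ fun t => ?_)
    have h1 : Λ t (0, 1) = t • ((0 : E), (1 : ℝ)) := by simp [Λ]
    change w t • fderiv ℝ H (p.1, t * p.2) (Λ t (0, 1)) = _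
    rw [h1, map_smul, smul_smul, mul_comm]
    simp only [pow_one]

/-- The average is as regular as the function, since each derivative of it is again an average. -/
theorem contDiff_dilationAverage [CompleteSpace F] (n : ℕ) : ∀ {w : ℝ → ℝ}, HasMoments w →
    ∀ {H : E × ℝ → F}, BoundedSupp H → ContDiff ℝ n H → ContDiff ℝ n (dilationAverage w H) := by
  induction n with
  | zero =>
    intro w hw H hs hc
    exact contDiff_zero.2 (continuous_dilationAverage hw hs (contDiff_zero.1 hc))
  | succ n ih =>
    intro w hw H hs hc
    have hc1 : ContDiff ℝ 1 H := hc.of_le (by exact_mod_cast Nat.le_add_left 1 n)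
    push_cast at hc ⊢
    rw [contDiff_succ_iff_fderiv_apply] at hc ⊢
    have hd := hasFDerivAt_dilationAverage hw hs hc1
    have hcy : Continuous fun q => (fderiv ℝ H q).comp (ContinuousLinearMap.inl ℝ E ℝ) := by
      have := hc1.continuous_fderiv one_ne_zero
      fun_prop
    have hsy : BoundedSupp fun q => (fderiv ℝ H q).comp (ContinuousLinearMap.inl ℝ E ℝ) :=
      hs.fderiv.clm_comp (ContinuousLinearMap.precomp F (ContinuousLinearMap.inl ℝ E ℝ))
    refine ⟨fun p => (hd p).differentiableAt, by simp, fun v => ?_⟩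
    have hv : (fun p => fderiv ℝ (dilationAverage w H) p v) = fun p =>
        dilationAverage w (fun q => fderiv ℝ H q (v.1, 0)) p +
          v.2 • dilationAverage (fun t => t ^ 1 * w t) (fun q => fderiv ℝ H q (0, 1)) p := by
      funext p
      rw [(hd p).fderiv, ContinuousLinearMap.coprod_apply,
        ContinuousLinearMap.toSpanSingleton_apply]
      congr 1
      rw [dilationAverage, ContinuousLinearMap.integral_apply (integrable_dilation hw hsy hcy p)]
      rfl
    rw [hv]
    exact (ih hw (hs.fderiv.clm_comp (ContinuousLinearMap.apply ℝ F (v.1, 0))) (hc.2.2 _)).add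
      ((ih (hw.pow_mul 1) (hs.fderiv.clm_comp (ContinuousLinearMap.apply ℝ F (0, 1)))
        (hc.2.2 _)).const_smul v.2)

end Moment

section Hadamard

variable {E F : Type*} [NormedAddCommGroup E] [NormedSpace ℝ E]
  [NormedAddCommGroup F] [NormedSpace ℝ F]

theorem hasMoments_indicator : HasMoments ((Ioc (0 : ℝ) 1).indicator fun _ => 1) := by
  intro j
  have : (fun t : ℝ => t ^ j * (Ioc (0 : ℝ) 1).indicator (fun _ => (1 : ℝ)) t) =
      (Ioc (0 : ℝ) 1).indicator fun t => t ^ j := by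
    funext t
    by_cases ht : t ∈ Ioc (0 : ℝ) 1 <;> simp [ht]
  rw [this]
  refine IntegrableOn.integrable_indicator ?_ measurableSet_Ioc
  exact (continuous_pow j).integrableOn_Icc.mono_set Ioc_subset_Icc_self

/-- The quotient `H(y, b) / b` of a function vanishing for `b = 0`, written as
`∫₀¹ ∂_b H(y, τ b) dτ`. -/
noncomputable def hadamardQuotient (H : E × ℝ → F) : E × ℝ → F :=
  dilationAverage ((Ioc (0 : ℝ) 1).indicator fun _ => 1) fun q => fderiv ℝ H q (0, 1)

theorem contDiff_hadamardQuotient [FiniteDimensional ℝ E] [CompleteSpace F] {n : ℕ}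
    {H : E × ℝ → F} (hs : BoundedSupp H) (hc : ContDiff ℝ (n + 1) H) :
    ContDiff ℝ n (hadamardQuotient H) :=
  contDiff_dilationAverage n hasMoments_indicator
    (hs.fderiv.clm_comp (ContinuousLinearMap.apply ℝ F (0, 1)))
    ((contDiff_succ_iff_fderiv_apply.1 hc).2.2 _)

theorem smul_hadamardQuotient [CompleteSpace F] {H : E × ℝ → F} (hc : ContDiff ℝ 1 H)
    (h0 : ∀ y, H (y, 0) = 0) (p : E × ℝ) : p.2 • hadamardQuotient H p = H p := by
  have h1 : hadamardQuotient H p = ∫ t in (0 : ℝ)..1, fderiv ℝ H (p.1, t * p.2) (0, 1) := by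
    rw [intervalIntegral.integral_of_le zero_le_one, ← integral_indicator measurableSet_Ioc]
    refine integral_congr_ae (ae_of_all _ fun t => ?_)
    by_cases ht : t ∈ Ioc (0 : ℝ) 1 <;> simp [ht]
  rw [h1, ← intervalIntegral.integral_smul]
  have hd : ∀ t : ℝ, HasDerivAt (fun t : ℝ => H (p.1, t * p.2))
      (p.2 • fderiv ℝ H (p.1, t * p.2) (0, 1)) t := by
    intro t
    have h2 : HasDerivAt (fun t : ℝ => (p.1, t * p.2)) ((0 : E), p.2) t :=
      (hasDerivAt_const t p.1).prodMk (by simpa using (hasDerivAt_id t).mul_const p.2)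
    have h3 := (hc.differentiable one_ne_zero (p.1, t * p.2)).hasFDerivAt.comp_hasDerivAt t h2
    have h4 : ((0 : E), p.2) = p.2 • ((0 : E), (1 : ℝ)) := by simp
    rwa [h4, map_smul] at h3
  have hcf := hc.continuous_fderiv one_ne_zero
  rw [intervalIntegral.integral_eq_sub_of_hasDerivAt (fun t _ => hd t)
    (Continuous.intervalIntegrable (by fun_prop) _ _)]
  simp [h0]

theorem BoundedSupp.of_smul_eq {E F : Type*} [NormedAddCommGroup F] [NormedSpace ℝ F]
    {H K : E × ℝ → F} (hs : BoundedSupp H)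
    (h : ∀ p, p.2 • K p = H p) : BoundedSupp K := by
  obtain ⟨R, hR⟩ := hs
  refine ⟨max R 0, fun p hp => ?_⟩
  have h1 := h p
  rw [hR p ((le_max_left _ _).trans_lt hp)] at h1
  exact (smul_eq_zero.1 h1).resolve_left (abs_pos.1 ((le_max_right _ _).trans_lt hp))

end Hadamard

section Fold

variable {E F : Type*} [NormedAddCommGroup E] [NormedSpace ℝ E]
  [NormedAddCommGroup F] [NormedSpace ℝ F]

/-- A weight whose even moments are those of the (nonexistent) point mass at `√-1`. -/
structure IsReflectionWeight (κ : ℝ → ℝ) : Prop where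
  hasMoments : HasMoments κ
  integral_pow : ∀ j : ℕ, ∫ t, t ^ (2 * j) * κ t = (-1) ^ j

/-- For an even function `H(y, b)` and `m = 0`, the function `G(y, u)` with `H(y, b) = G(y, b²)`;
it is extended to `u < 0` by replacing `H(y, √u)` with an average of the values `H(y, t √-u)`.
The derivatives in `u` produce the cases `m > 0`. -/
noncomputable def fold (κ : ℝ → ℝ) (m : ℕ) (H : E × ℝ → F) (p : E × ℝ) : F :=
  if 0 ≤ p.2 then H (p.1, √p.2)
  else (-1 : ℝ) ^ m • dilationAverage (fun t => t ^ (2 * m) * κ t) H (p.1, √(-p.2))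

omit [NormedAddCommGroup E] [NormedSpace ℝ E] in
theorem fold_of_nonneg (κ : ℝ → ℝ) (m : ℕ) (H : E × ℝ → F) {p : E × ℝ} (hp : 0 ≤ p.2) :
    fold κ m H p = H (p.1, √p.2) := if_pos hp

omit [NormedAddCommGroup E] [NormedSpace ℝ E] in
theorem fold_of_nonpos {κ : ℝ → ℝ} (hκ : IsReflectionWeight κ) [CompleteSpace F] (m : ℕ)
    (H : E × ℝ → F) {p : E × ℝ} (hp : p.2 ≤ 0) : fold κ m H p =
      (-1 : ℝ) ^ m • dilationAverage (fun t => t ^ (2 * m) * κ t) H (p.1, √(-p.2)) := by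
  rcases hp.lt_or_eq with h | h
  · exact if_neg (not_le.2 h)
  · rw [fold_of_nonneg κ m H h.ge]
    simp only [h, neg_zero, Real.sqrt_zero, dilationAverage, mul_zero]
    rw [integral_smul_const, hκ.integral_pow, smul_smul, ← mul_pow]
    simp

/-- A continuous function is differentiable across the hyperplane `u = 0` if its derivative off the
hyperplane extends continuously. -/
theorem hasFDerivAt_of_snd_ne_zero {f : E × ℝ → F} {D : E × ℝ → E × ℝ →L[ℝ] F}
    (hf : Continuous f) (hD : Continuous D)
    (h : ∀ p : E × ℝ, p.2 ≠ 0 → HasFDerivAt f (D p) p) (p : E × ℝ) : HasFDerivAt f (D p) p := by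
  have side : ∀ s : Set (E × ℝ), IsOpen s → Convex ℝ s → (∀ q ∈ s, q.2 ≠ 0) →
      HasFDerivWithinAt f (D p) (closure s) p := by
    intro s hso hsc hs
    refine hasFDerivWithinAt_closure_of_tendsto_fderiv
      (fun q hq => (h q (hs q hq)).differentiableAt.differentiableWithinAt) hsc hso
      (fun q _ => hf.continuousWithinAt) ?_
    refine (hD.continuousWithinAt (s := s) (x := p)).tendsto.congr' ?_
    filter_upwards [self_mem_nhdsWithin] with q hq using (h q (hs q hq)).fderiv.symm
  have hup := side (univ ×ˢ Ioi 0) (isOpen_univ.prod isOpen_Ioi)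
    (convex_univ.prod (convex_Ioi 0)) fun q hq => (mem_Ioi.1 hq.2).ne'
  have hdown := side (univ ×ˢ Iio 0) (isOpen_univ.prod isOpen_Iio)
    (convex_univ.prod (convex_Iio 0)) fun q hq => (mem_Iio.1 hq.2).ne
  rw [closure_prod_eq, closure_univ, closure_Ioi] at hup
  rw [closure_prod_eq, closure_univ, closure_Iio] at hdown
  refine (hup.union hdown).hasFDerivAt (mem_of_superset univ_mem fun q _ => ?_)
  rcases le_total 0 q.2 with hq | hq
  · exact Or.inl ⟨mem_univ _, hq⟩
  · exact Or.inr ⟨mem_univ _, hq⟩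

variable [FiniteDimensional ℝ E] [CompleteSpace F]

theorem continuous_fold {κ : ℝ → ℝ} (hκ : IsReflectionWeight κ) (m : ℕ) {H : E × ℝ → F}
    (hs : BoundedSupp H) (hc : Continuous H) : Continuous (fold κ m H) := by
  have hd := continuous_dilationAverage (hκ.hasMoments.pow_mul (2 * m)) hs hc
  refine Continuous.if_le (by fun_prop) ?_ continuous_const continuous_snd ?_
  · exact continuous_const.smul (hd.comp (by fun_prop))
  · intro p hp
    rw [← fold_of_nonpos hκ m H hp.ge, fold_of_nonneg κ m H hp.le]

/-- The derivative of a fold of an even function `H`; evenness enters through the hypothesis that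
`∂_b H` is divisible by `b`. -/
theorem hasFDerivAt_fold {κ : ℝ → ℝ} (hκ : IsReflectionWeight κ) (m : ℕ) {H H₁ : E × ℝ → F}
    (hs : BoundedSupp H) (hc : ContDiff ℝ 1 H) (hs₁ : BoundedSupp H₁) (hc₁ : Continuous H₁)
    (h : ∀ p, fderiv ℝ H p (0, 1) = (2 * p.2) • H₁ p) (p : E × ℝ) :
    HasFDerivAt (fold κ m H)
      ((fold κ m (fun q => (fderiv ℝ H q).comp (ContinuousLinearMap.inl ℝ E ℝ)) p).coprod
        (ContinuousLinearMap.toSpanSingleton ℝ (fold κ (m + 1) H₁ p))) p := by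
  set D : E × ℝ → E × ℝ →L[ℝ] F := fun p =>
    (fold κ m (fun q => (fderiv ℝ H q).comp (ContinuousLinearMap.inl ℝ E ℝ)) p).coprod
        (ContinuousLinearMap.toSpanSingleton ℝ (fold κ (m + 1) H₁ p)) with hD
  have hcy : Continuous fun q => (fderiv ℝ H q).comp (ContinuousLinearMap.inl ℝ E ℝ) := by
    have := hc.continuous_fderiv one_ne_zero
    fun_prop
  have hsy : BoundedSupp fun q => (fderiv ℝ H q).comp (ContinuousLinearMap.inl ℝ E ℝ) :=
    hs.fderiv.clm_comp (ContinuousLinearMap.precomp F (ContinuousLinearMap.inl ℝ E ℝ))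
  have hDc : Continuous D := by
    have h1 := continuous_fold hκ m hsy hcy
    have h2 := continuous_fold hκ (m + 1) hs₁ hc₁
    have h3 : D = fun p => (fold κ m (fun q => (fderiv ℝ H q).comp
        (ContinuousLinearMap.inl ℝ E ℝ)) p).comp (ContinuousLinearMap.fst ℝ E ℝ) +
        (ContinuousLinearMap.toSpanSingletonCLE (fold κ (m + 1) H₁ p)).comp
          (ContinuousLinearMap.snd ℝ E ℝ) := by
      funext p; ext <;> simp [hD]
    rw [h3]
    fun_prop
  have hpos : ∀ p : E × ℝ, 0 < p.2 → HasFDerivAt (fold κ m H) (D p) p := by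
    intro p hp
    have he : fold κ m H =ᶠ[𝓝 p] H ∘ fun q => (q.1, √q.2) := by
      filter_upwards [(isOpen_lt continuous_const continuous_snd).mem_nhds hp] with q hq
      exact fold_of_nonneg κ m H (le_of_lt hq)
    refine HasFDerivAt.congr_of_eventuallyEq ?_ he
    have hs : HasFDerivAt (fun q : E × ℝ => (q.1, √q.2)) _ p :=
      (hasFDerivAt_fst (𝕜 := ℝ)).prodMk ((hasFDerivAt_snd (𝕜 := ℝ)).sqrt hp.ne')
    refine ((hc.differentiable one_ne_zero _).hasFDerivAt.comp p hs).congr_fderiv ?_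
    have hne : √p.2 ≠ 0 := (Real.sqrt_pos.2 hp).ne'
    ext v
    · simp [hD, fold_of_nonneg κ _ _ hp.le]
    · simp only [hD, fold_of_nonneg κ _ _ hp.le, ContinuousLinearMap.comp_apply,
        ContinuousLinearMap.inr_apply, ContinuousLinearMap.coprod_apply, map_zero, zero_add,
        ContinuousLinearMap.toSpanSingleton_apply, one_smul]
      have h4 : ∀ c : ℝ, ((0 : E), c) = c • ((0 : E), (1 : ℝ)) := by simp
      have h5 : ((ContinuousLinearMap.fst ℝ E ℝ).prod ((1 / (2 * √p.2)) •
          ContinuousLinearMap.snd ℝ E ℝ)) (0, 1) = (1 / (2 * √p.2)) • ((0 : E), (1 : ℝ)) := by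
        simp
      rw [h5, map_smul, h, smul_smul]
      have : 1 / (2 * √p.2) * (2 * √p.2) = 1 := by field_simp
      rw [this, one_smul]
  have hneg : ∀ p : E × ℝ, p.2 < 0 → HasFDerivAt (fold κ m H) (D p) p := by
    intro p hp
    have hp' : 0 < -p.2 := neg_pos.2 hp
    set w : ℝ → ℝ := fun t => t ^ (2 * m) * κ t with hw
    have hwm : HasMoments w := hκ.hasMoments.pow_mul _
    have he : fold κ m H =ᶠ[𝓝 p]
        fun q => (-1 : ℝ) ^ m • (dilationAverage w H ∘ fun q : E × ℝ => (q.1, √(-q.2))) q := by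
      filter_upwards [(isOpen_lt continuous_snd continuous_const).mem_nhds hp] with q hq
      exact fold_of_nonpos hκ m H (le_of_lt hq)
    refine HasFDerivAt.congr_of_eventuallyEq ?_ he
    have hsq : HasFDerivAt (fun q : E × ℝ => (q.1, √(-q.2)))
        ((ContinuousLinearMap.fst ℝ E ℝ).prod ((1 / (2 * √(-p.2))) •
          -ContinuousLinearMap.snd ℝ E ℝ)) p :=
      (hasFDerivAt_fst (𝕜 := ℝ)).prodMk ((hasFDerivAt_snd (𝕜 := ℝ)).neg.sqrt hp'.ne')
    refine (((hasFDerivAt_dilationAverage hwm hs hc _).comp p hsq).const_smul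
      ((-1 : ℝ) ^ m)).congr_fderiv ?_
    have hne : √(-p.2) ≠ 0 := (Real.sqrt_pos.2 hp').ne'
    ext v
    · simp [hD, fold_of_nonpos hκ _ _ hp.le, w]
    · have h6 : dilationAverage (fun t => t ^ 1 * w t) (fun q => fderiv ℝ H q (0, 1))
          (p.1, √(-p.2)) = (2 * √(-p.2)) • dilationAverage (fun t => t ^ (2 * (m + 1)) * κ t) H₁
            (p.1, √(-p.2)) := by
        rw [dilationAverage, dilationAverage, ← integral_smul]
        refine integral_congr_ae (ae_of_all _ fun t => ?_)
        simp only [h, smul_smul, hw]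
        congr 1
        ring
      have h5 : ((ContinuousLinearMap.fst ℝ E ℝ).prod ((1 / (2 * √(-p.2))) •
          -ContinuousLinearMap.snd ℝ E ℝ)) (0, 1) = ((0 : E), -(1 / (2 * √(-p.2)))) := by
        simp
      simp only [hD, fold_of_nonpos hκ _ _ hp.le, ContinuousLinearMap.comp_apply,
        ContinuousLinearMap.inr_apply, ContinuousLinearMap.coprod_apply, map_zero, zero_add,
        ContinuousLinearMap.toSpanSingleton_apply, one_smul, smul_apply]
      rw [h5]
      simp only [map_zero, zero_add, h6, smul_smul]
      congr 1
      field_simp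
      ring
  exact hasFDerivAt_of_snd_ne_zero (continuous_fold hκ m hs hc.continuous) hDc
    (fun q hq => hq.lt_or_gt.elim (hneg q) (hpos q)) p

end Fold

end SliceFunctions

/-! ### Whitney's theorem on even functions -/

namespace SliceFunctions

open MeasureTheory Filter Topology Set
open scoped ContDiff FourierTransform

section FoldSmooth

variable {E F : Type*} [NormedAddCommGroup E] [NormedSpace ℝ E]
  [NormedAddCommGroup F] [NormedSpace ℝ F]

omit [NormedAddCommGroup E] [NormedSpace ℝ E] in
theorem fold_equivariant (κ : ℝ → ℝ) (m : ℕ) {H : E × ℝ → F} {y y' : E} {c : ℝ}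
    (h : ∀ b, H (y', b) = c • H (y, b)) (u : ℝ) : fold κ m H (y', u) = c • fold κ m H (y, u) := by
  unfold fold
  split_ifs
  · exact h _
  · simp only [dilationAverage, h]
    rw [smul_comm c, ← integral_smul c]
    congr 2
    funext t
    exact smul_comm _ _ _

omit [NormedAddCommGroup E] [NormedSpace ℝ E] in
theorem fold_sq (κ : ℝ → ℝ) (m : ℕ) {H : E × ℝ → F} (he : ∀ y b, H (y, -b) = H (y, b))
    (y : E) (b : ℝ) : fold κ m H (y, b ^ 2) = H (y, b) := by
  rw [fold_of_nonneg κ m H (sq_nonneg b), Real.sqrt_sq_eq_abs]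
  rcases abs_choice b with h | h <;> simp [h, he]

theorem fderiv_neg_of_even {H : E × ℝ → F} (hc : ContDiff ℝ 1 H)
    (he : ∀ y b, H (y, -b) = H (y, b)) (y : E) (b : ℝ) :
    fderiv ℝ H (y, -b) (0, 1) = -fderiv ℝ H (y, b) (0, 1) := by
  have hd : ∀ b : ℝ, HasDerivAt (fun b => H (y, b)) (fderiv ℝ H (y, b) (0, 1)) b := fun b =>
    (hc.differentiable one_ne_zero (y, b)).hasFDerivAt.comp_hasDerivAt b
      ((hasDerivAt_const b y).prodMk (hasDerivAt_id b))
  have h1 := (hd (-b)).scomp b (hasDerivAt_neg b)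
  have h2 : (fun b => H (y, b)) ∘ Neg.neg = fun b => H (y, b) := by
    funext b; exact he y b
  rw [h2] at h1
  have := h1.unique (hd b)
  rw [neg_one_smul] at this
  rw [← this, neg_neg]

variable [FiniteDimensional ℝ E] [CompleteSpace F]

theorem fold_clm_comp {G : Type*} [NormedAddCommGroup G] [NormedSpace ℝ G] [CompleteSpace G]
    {κ : ℝ → ℝ} (hκ : IsReflectionWeight κ) (m : ℕ) (L : F →L[ℝ] G) {H : E × ℝ → F}
    (hs : BoundedSupp H) (hc : Continuous H) (p : E × ℝ) :
    fold κ m (fun q => L (H q)) p = L (fold κ m H p) := by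
  unfold fold
  split_ifs
  · rfl
  · rw [map_smul, dilationAverage, dilationAverage, ← L.integral_comp_comm
      (integrable_dilation (hκ.hasMoments.pow_mul _) hs hc _)]
    simp only [map_smul]

/-- Whitney's theorem on even functions, with a loss of half of the derivatives. -/
theorem contDiff_fold {κ : ℝ → ℝ} (hκ : IsReflectionWeight κ) (s : ℕ) :
    ∀ (m : ℕ) {H : E × ℝ → F}, BoundedSupp H → (∀ y b, H (y, -b) = H (y, b)) →
      ContDiff ℝ (2 * s : ℕ) H → ContDiff ℝ s (fold κ m H) := by
  induction s with
  | zero =>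
    intro m H hs _ hc
    exact contDiff_zero.2 (continuous_fold hκ m hs hc.continuous)
  | succ s ih =>
    intro m H hs he hc
    have hc1 : ContDiff ℝ 1 H := hc.of_le (by norm_cast; lia)
    have hc2 : ContDiff ℝ ((2 * s + 1 : ℕ) + 1) H := by
      have : 2 * (s + 1) = 2 * s + 1 + 1 := by ring
      rw [this] at hc
      exact_mod_cast hc
    -- the function `H₁ = ∂_b H / 2b` is again even, with two derivatives less
    have hdc : ∀ v : E × ℝ, ContDiff ℝ (2 * s + 1 : ℕ) fun p => fderiv ℝ H p v :=
      (contDiff_succ_iff_fderiv_apply (𝕜 := ℝ).1 hc2).2.2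
    have hds : ∀ v : E × ℝ, BoundedSupp fun p => fderiv ℝ H p v := fun v =>
      (BoundedSupp.fderiv hs).clm_comp (ContinuousLinearMap.apply ℝ F v)
    have hodd := fderiv_neg_of_even hc1 he
    have hd0 : ∀ y, fderiv ℝ H (y, 0) (0, 1) = 0 := fun y => by
      have h1 := hodd y 0
      rw [neg_zero] at h1
      rw [eq_neg_iff_add_eq_zero, ← two_smul ℝ] at h1
      exact (smul_eq_zero.1 h1).resolve_left two_ne_zero
    set K := hadamardQuotient fun p => fderiv ℝ H p (0, 1) with hK
    have hKc : ContDiff ℝ (2 * s : ℕ) K := contDiff_hadamardQuotient (hds _)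
      (by exact_mod_cast hdc (0, 1))
    have hKe : ∀ p, p.2 • K p = fderiv ℝ H p (0, 1) :=
      smul_hadamardQuotient ((hdc _).of_le (by norm_cast; lia)) hd0
    have hKs : BoundedSupp K := (hds (0, 1)).of_smul_eq hKe
    have hKeven : ∀ y b, K (y, -b) = K (y, b) := by
      intro y b
      by_cases hb : b = 0
      · simp [hb]
      · have h1 := hKe (y, -b)
        rw [hodd, ← hKe (y, b)] at h1
        simp only [neg_smul, neg_inj] at h1
        exact smul_right_injective F hb h1
    have hd := hasFDerivAt_fold hκ m (H₁ := fun p => (1 / 2 : ℝ) • K p) hs hc1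
      (by obtain ⟨R, hR⟩ := hKs; exact ⟨R, fun p hp => by simp [hR p hp]⟩)
      (hKc.continuous.const_smul _) (fun p => by rw [← hKe p, smul_smul]; congr 1; ring)
    push_cast
    rw [contDiff_succ_iff_fderiv_apply]
    refine ⟨fun p => (hd p).differentiableAt, by simp, fun v => ?_⟩
    have hv : (fun p => fderiv ℝ (fold κ m H) p v) = fun p =>
        fold κ m (fun q => fderiv ℝ H q (v.1, 0)) p +
          v.2 • fold κ (m + 1) (fun p => (1 / 2 : ℝ) • K p) p := by
      funext p
      rw [(hd p).fderiv, ContinuousLinearMap.coprod_apply,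
        ContinuousLinearMap.toSpanSingleton_apply]
      congr 1
      have hcf := hc1.continuous_fderiv one_ne_zero
      exact (fold_clm_comp hκ m (ContinuousLinearMap.apply ℝ F v.1)
        (hs.fderiv.clm_comp (ContinuousLinearMap.precomp F (ContinuousLinearMap.inl ℝ E ℝ)))
        (by simp only [ContinuousLinearMap.precomp_apply]; fun_prop) p).symm
    rw [hv]
    refine (ih m (hds _) (fun y b => ?_) ((hdc _).of_le (by norm_cast; lia))).add
      ((ih (m + 1) ?_ (fun y b => by simp [hKeven]) (hKc.const_smul _)).const_smul _)
    · -- the derivative in a direction of `E` of an even function is even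
      let σ : E × ℝ →L[ℝ] E × ℝ :=
        (ContinuousLinearMap.fst ℝ E ℝ).prod (-ContinuousLinearMap.snd ℝ E ℝ)
      have h1 : H ∘ σ = H := by
        funext p; exact he p.1 p.2
      have h2 := ((hc1.differentiable one_ne_zero (σ (y, b))).hasFDerivAt.comp (y, b)
        σ.hasFDerivAt).fderiv
      rw [h1] at h2
      rw [h2]
      simp [σ]
    · obtain ⟨R, hR⟩ := hKs
      exact ⟨R, fun p hp => by simp [hR p hp]⟩

end FoldSmooth

/-- A reflection weight is the real part of the inverse Fourier transform of a compactly supported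
smooth function which coincides with `x ↦ exp (2 π x)` near the origin. -/
theorem exists_isReflectionWeight : ∃ κ : ℝ → ℝ, IsReflectionWeight κ := by
  let b : ContDiffBump (0 : ℝ) := default
  let f : ℝ → ℂ := fun x => ((b x * Real.exp (2 * Real.pi * x) : ℝ) : ℂ)
  have hf : ContDiff ℝ ∞ f := by
    have h1 : ContDiff ℝ ∞ fun x => b x * Real.exp (2 * Real.pi * x) :=
      b.contDiff.mul (by fun_prop)
    exact Complex.ofRealCLM.contDiff.comp h1
  have hfs : HasCompactSupport f := by
    refine HasCompactSupport.comp_left (g := fun x : ℝ => (x : ℂ)) ?_ (by simp)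
    exact b.hasCompactSupport.mul_right
  let ψ : SchwartzMap ℝ ℂ := hfs.toSchwartzMap hf
  let k : SchwartzMap ℝ ℂ := 𝓕⁻ ψ
  have hk : 𝓕 (k : ℝ → ℂ) = f := by
    have h1 : 𝓕 k = ψ := FourierTransform.fourier_fourierInv_eq ψ
    rw [← SchwartzMap.fourier_coe, h1]
    rfl
  have hint : ∀ j : ℕ, Integrable fun t : ℝ => t ^ j • k t := by
    intro j
    refine (k.integrable_pow_mul volume j).mono' (by fun_prop) (ae_of_all _ fun t => ?_)
    simp
  have hmom : ∀ j : ℕ, ∫ t : ℝ, t ^ j • k t = Complex.I ^ j := by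
    intro j
    have h1 : iteratedDeriv j (𝓕 (k : ℝ → ℂ)) 0 = _ :=
      congrFun (Real.iteratedDeriv_fourier (N := ⊤) (fun j _ => hint j) le_top) 0
    have h2 : f =ᶠ[𝓝 0] fun x : ℝ => Complex.exp ((2 * Real.pi : ℂ) * x) := by
      filter_upwards [b.eventuallyEq_one] with x hx
      simp [f, hx]
    have h3 : ∀ j, iteratedDeriv j (fun x : ℝ => Complex.exp ((2 * Real.pi : ℂ) * x)) =
        fun x : ℝ => (2 * Real.pi : ℂ) ^ j * Complex.exp ((2 * Real.pi : ℂ) * x) := by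
      intro j
      induction j with
      | zero => simp
      | succ j ih =>
        rw [iteratedDeriv_succ, ih]
        funext x
        have h4 : HasDerivAt (fun x : ℝ => Complex.exp ((2 * Real.pi : ℂ) * x))
            (Complex.exp ((2 * Real.pi : ℂ) * x) * ((2 * Real.pi : ℂ) * 1)) x :=
          ((hasDerivAt_id x).ofReal_comp.const_mul (2 * Real.pi : ℂ)).cexp
        rw [(h4.const_mul _).deriv]
        ring
    rw [hk, h2.iteratedDeriv_eq, h3] at h1
    rw [Real.fourier_eq'] at h1
    have h5 : ∀ t : ℝ, (-2 * Real.pi * Complex.I * t) ^ j • k t =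
        (-2 * Real.pi * Complex.I) ^ j * (t ^ j • k t) := by
      intro t
      simp; ring
    simp only [h5, inner_zero_right, mul_zero, Complex.ofReal_zero, zero_mul, Complex.exp_zero,
      one_smul, mul_one] at h1
    rw [integral_const_mul] at h1
    have hpi : (2 * Real.pi : ℂ) ^ j ≠ 0 := by
      simp [Real.pi_ne_zero]
    have h6 : (-2 * Real.pi * Complex.I) ^ j = (2 * Real.pi : ℂ) ^ j * (-Complex.I) ^ j := by
      rw [← mul_pow]; ring
    rw [h6, mul_assoc] at h1
    have h7 : (-Complex.I) ^ j * ∫ t : ℝ, t ^ j • k t = 1 :=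
      mul_left_cancel₀ hpi (by rw [← h1, mul_one])
    calc ∫ t : ℝ, t ^ j • k t
        = (Complex.I ^ j * (-Complex.I) ^ j) * ∫ t : ℝ, t ^ j • k t := by
          rw [← mul_pow]; simp
      _ = Complex.I ^ j := by rw [mul_assoc, h7, mul_one]
  refine ⟨fun t => (k t).re, fun j => ?_, fun j => ?_⟩
  · refine (hint j).re.congr (ae_of_all _ fun t => ?_)
    simp only [RCLike.re_to_complex, Complex.smul_re, smul_eq_mul]
  · have h1 := integral_re (hint (2 * j))
    rw [hmom, pow_mul, Complex.I_sq] at h1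
    have h2 : ((-1 : ℂ) ^ j) = (((-1 : ℝ) ^ j : ℝ) : ℂ) := by push_cast; rfl
    rw [h2] at h1
    simpa only [RCLike.re_to_complex, Complex.smul_re, Complex.ofReal_re, smul_eq_mul] using h1

end SliceFunctions

/-! ### Folding the coordinates of a function on `ℂⁿ` -/

namespace SliceFunctions

open MeasureTheory Filter Topology Set
open scoped ContDiff

section Coordinates

variable {n : ℕ}

/-- The point `z` with the imaginary part of its `h`-th coordinate replaced by `b`. -/
def setIm (h : Fin n) (z : Fin n → ℂ) (b : ℝ) : Fin n → ℂ :=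
  Function.update z h ⟨(z h).re, b⟩

/-- The point `z` with the imaginary parts of the coordinates in `S` replaced by their squares. -/
def sqOn (S : Finset (Fin n)) (z : Fin n → ℂ) : Fin n → ℂ :=
  fun k => if k ∈ S then ⟨(z k).re, (z k).im ^ 2⟩ else z k

/-- The parity of the component `F_K` of a stem function in the `k`-th coordinate. -/
def paritySign (K : Finset (Fin n)) (k : Fin n) : ℝ := if k ∈ K then -1 else 1

theorem setIm_setIm (h : Fin n) (z : Fin n → ℂ) (b c : ℝ) :
    setIm h (setIm h z b) c = setIm h z c := by
  simp [setIm]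

theorem setIm_self (h : Fin n) (z : Fin n → ℂ) : setIm h z (z h).im = z := by
  simp [setIm]

theorem conjAt_setIm (h : Fin n) (z : Fin n → ℂ) (b : ℝ) :
    conjAt h (setIm h z b) = setIm h z (-b) := by
  have : (starRingEnd ℂ) (⟨(z h).re, b⟩ : ℂ) = ⟨(z h).re, -b⟩ := Complex.ext rfl rfl
  simp [setIm, conjAt, this]

theorem conjAt_setIm_of_ne {h k : Fin n} (hk : k ≠ h) (z : Fin n → ℂ) (b : ℝ) :
    conjAt k (setIm h z b) = setIm h (conjAt k z) b := by
  simp only [setIm, conjAt, Function.update_of_ne hk, Function.update_of_ne hk.symm]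
  exact Function.update_comm hk.symm _ _ _

theorem sqOn_insert {h : Fin n} {S : Finset (Fin n)} (hS : h ∉ S) (z : Fin n → ℂ) :
    sqOn (insert h S) z = setIm h (sqOn S z) ((z h).im ^ 2) := by
  funext k
  by_cases hk : k = h
  · subst hk; simp [sqOn, setIm, hS]
  · simp [sqOn, setIm, hk]

theorem contDiff_setIm (h : Fin n) {m : WithTop ℕ∞} :
    ContDiff ℝ m fun p : (Fin n → ℂ) × ℝ => setIm h p.1 p.2 := by
  refine contDiff_pi.2 fun k => ?_
  by_cases hk : k = h
  · subst hk
    have h1 : (fun p : (Fin n → ℂ) × ℝ => setIm k p.1 p.2 k) =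
        fun p => Complex.ofRealCLM (Complex.reCLM (p.1 k)) + p.2 • Complex.I := by
      funext p
      apply Complex.ext <;> simp [setIm]
    rw [h1]
    fun_prop
  · simp only [setIm, Function.update_of_ne hk]
    fun_prop

end Coordinates

section FoldCoordinate

variable {E F : Type*} [NormedAddCommGroup E] [NormedSpace ℝ E]
  [NormedAddCommGroup F] [NormedSpace ℝ F]

theorem hadamardQuotient_equivariant {H : E × ℝ → F} (hc : ContDiff ℝ 1 H)
    {y y' : E} {c : ℝ} (h : ∀ b, H (y', b) = c • H (y, b)) (b : ℝ) :
    hadamardQuotient H (y', b) = c • hadamardQuotient H (y, b) := by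
  have hd : ∀ y (b : ℝ), HasDerivAt (fun b => H (y, b)) (fderiv ℝ H (y, b) (0, 1)) b := fun y b =>
    (hc.differentiable one_ne_zero (y, b)).hasFDerivAt.comp_hasDerivAt b
      ((hasDerivAt_const b y).prodMk (hasDerivAt_id b))
  have h1 : ∀ b, fderiv ℝ H (y', b) (0, 1) = c • fderiv ℝ H (y, b) (0, 1) := by
    intro b
    have h2 := (hd y b).const_smul c
    have h3 : (c • fun b => H (y, b)) = fun b => H (y', b) := funext fun b => (h b).symm
    rw [h3] at h2
    exact (hd y' b).unique h2
  simp only [hadamardQuotient, dilationAverage, h1]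
  rw [← integral_smul c]
  congr 1
  funext t
  exact smul_comm _ _ _

variable {n : ℕ} [CompleteSpace F]

/-- A function which is even or odd in the `h`-th coordinate is a smooth function of the square of
the imaginary part of that coordinate, up to a factor `(z h).im` in the odd case. The symmetries and
vanishing conditions in the other coordinates are inherited. -/
theorem exists_fold_coordinate (K : Finset (Fin n)) (h : Fin n) {H : (Fin n → ℂ) → F}
    (hc : ContDiff ℝ 1 H) (hs : ∃ R : ℝ, ∀ z, R < |(z h).im| → H z = 0)
    (hp : ∀ z, H (conjAt h z) = paritySign K h • H z) :
    ∃ G : (Fin n → ℂ) → F,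
      (∀ s : ℕ, ContDiff ℝ (2 * s + 1 : ℕ) H → ContDiff ℝ s G) ∧
      (∀ z, H z = (if h ∈ K then (z h).im else 1) • G (setIm h z ((z h).im ^ 2))) ∧
      (∀ k ≠ h, ∀ c : ℝ, (∀ z, H (conjAt k z) = c • H z) → ∀ z, G (conjAt k z) = c • G z) ∧
      (∀ k ≠ h, ∀ R : ℝ, (∀ z, R < |(z k).im| → H z = 0) → ∀ z, R < |(z k).im| → G z = 0) := by
  obtain ⟨κ, hκ⟩ := exists_isReflectionWeight
  set H' : (Fin n → ℂ) × ℝ → F := fun p => H (setIm h p.1 p.2) with hH'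
  have hH'c : ∀ {m : WithTop ℕ∞}, ContDiff ℝ m H → ContDiff ℝ m H' := fun hm =>
    hm.comp (contDiff_setIm h)
  have hH's : BoundedSupp H' := by
    obtain ⟨R, hR⟩ := hs
    exact ⟨R, fun p hp => hR _ (by simpa [setIm] using hp)⟩
  have hH'p : ∀ y b, H' (y, -b) = paritySign K h • H' (y, b) := by
    intro y b
    simp only [hH', ← hp, conjAt_setIm]
  obtain ⟨K', hK's, hK'e, hK'c, hK'H, hK'q⟩ : ∃ K' : (Fin n → ℂ) × ℝ → F, BoundedSupp K' ∧
      (∀ y b, K' (y, -b) = K' (y, b)) ∧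
      (∀ s : ℕ, ContDiff ℝ (2 * s + 1 : ℕ) H → ContDiff ℝ (2 * s : ℕ) K') ∧
      (∀ p, H' p = (if h ∈ K then p.2 else 1) • K' p) ∧
      (∀ (y y' : Fin n → ℂ) (c : ℝ), (∀ b, H' (y', b) = c • H' (y, b)) →
        ∀ b, K' (y', b) = c • K' (y, b)) := by
    by_cases hK : h ∈ K
    · simp only [paritySign, if_pos hK, neg_one_smul] at hH'p
      have h0 : ∀ y, H' (y, 0) = 0 := fun y => by
        have h1 := hH'p y 0
        rw [neg_zero, eq_neg_iff_add_eq_zero, ← two_smul ℝ] at h1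
        exact (smul_eq_zero.1 h1).resolve_left two_ne_zero
      have hq := smul_hadamardQuotient (hH'c hc) h0
      refine ⟨hadamardQuotient H', hH's.of_smul_eq hq, fun y b => ?_, fun s hs => ?_,
        fun p => ?_, fun y y' c hy => hadamardQuotient_equivariant (hH'c hc) hy⟩
      · by_cases hb : b = 0
        · simp [hb]
        · have h1 := hq (y, -b)
          rw [hH'p, ← hq (y, b)] at h1
          simp only [neg_smul, neg_inj] at h1
          exact smul_right_injective F hb h1
      · exact contDiff_hadamardQuotient hH's (by exact_mod_cast hH'c hs)
      · rw [if_pos hK, hq p]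
    · simp only [paritySign, if_neg hK, one_smul] at hH'p
      exact ⟨H', hH's, hH'p, fun s hs => (hH'c hs).of_le (by norm_cast; lia),
        fun p => by rw [if_neg hK, one_smul], fun _ _ _ hy => hy⟩
  have hfold : ∀ (y y' : Fin n → ℂ) (c : ℝ) (u : ℝ), (∀ b, H' (y', b) = c • H' (y, b)) →
      fold κ 0 K' (y', u) = c • fold κ 0 K' (y, u) := fun y y' c u hy =>
    fold_equivariant κ 0 (hK'q y y' c hy) u
  refine ⟨fun w => fold κ 0 K' (w, (w h).im), fun s hs => ?_, fun z => ?_, ?_, ?_⟩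
  · refine (contDiff_fold hκ s 0 hK's hK'e (hK'c s hs)).comp (contDiff_id.prodMk ?_)
    exact Complex.imCLM.contDiff.comp (contDiff_apply ℝ ℂ h)
  · have h1 : (setIm h z ((z h).im ^ 2) h).im = (z h).im ^ 2 := by simp [setIm]
    have h2 := hK'H (setIm h z ((z h).im ^ 2), (z h).im)
    simp only [h1, fold_sq κ 0 hK'e]
    rw [← h2, hH']
    simp only [setIm_setIm, setIm_self]
  · intro k hk c hkc z
    have h1 : (conjAt k z h).im = (z h).im := by simp [conjAt, Function.update_of_ne hk.symm]
    simp only [h1]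
    exact hfold _ _ _ _ fun b => by simp only [hH', ← conjAt_setIm_of_ne hk, hkc]
  · intro k hk R hR z hz
    have := hfold z z 0 (z h).im fun b => by
      have h1 : R < |(setIm h z b k).im| := by simpa [setIm, Function.update_of_ne hk] using hz
      simp only [hH', hR _ h1, smul_zero]
    simpa using this

/-- Whitney's theorem in several variables: a function with the parities of the component `F_K` of a
stem function is the product of `∏_{k ∈ K} (z k).im` and a function of the squares of the imaginary
parts. Each of the `n` variables costs half of the derivatives. -/
theorem exists_contDiff_sqOn (K : Finset (Fin n)) {H : (Fin n → ℂ) → F} {r : ℕ∞}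
    (hr : (2 ^ n : ℕ) ≤ r + 1) (hc : ContDiff ℝ r H)
    (hs : ∃ R : ℝ, ∀ k z, R < |(z k).im| → H z = 0)
    (hp : ∀ k z, H (conjAt k z) = paritySign K k • H z) :
    ∃ G : (Fin n → ℂ) → F,
      (∀ s : ℕ, (2 ^ n * (s + 1) : ℕ) ≤ r + 1 → ContDiff ℝ s G) ∧
      ∀ z, H z = (∏ k ∈ K, (z k).im) • G (sqOn Finset.univ z) := by
  obtain ⟨R, hR⟩ := hs
  have key : ∀ S : Finset (Fin n), ∃ G : (Fin n → ℂ) → F,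
      (∀ s : ℕ, (2 ^ S.card * (s + 1) : ℕ) ≤ r + 1 → ContDiff ℝ s G) ∧
      (∀ z, H z = (∏ k ∈ S, if k ∈ K then (z k).im else 1) • G (sqOn S z)) ∧
      (∀ k ∉ S, ∀ z, G (conjAt k z) = paritySign K k • G z) ∧
      (∀ k ∉ S, ∀ z, R < |(z k).im| → G z = 0) := by
    intro S
    induction S using Finset.induction_on with
    | empty =>
      refine ⟨H, fun s hs => hc.of_le ?_, fun z => ?_, fun k _ => hp k, fun k _ => hR k⟩
      · have h1 : ((s : ℕ∞) + 1) ≤ r + 1 := by simpa using hs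
        have h2 : (s : ℕ∞) ≤ r := by
          exact (ENat.add_le_add_iff_right ENat.one_ne_top).1 h1
        exact_mod_cast h2
      · have h1 : sqOn ∅ z = z := by funext k; simp [sqOn]
        simp [h1]
    | insert h S hS ih =>
      obtain ⟨G, hGc, hGH, hGp, hGs⟩ := ih
      have hcard : S.card + 1 ≤ n := by
        have := Finset.card_le_univ (insert h S)
        rwa [Finset.card_insert_of_notMem hS, Fintype.card_fin] at this
      have hG1 : ContDiff ℝ (1 : ℕ) G := by
        refine hGc 1 (le_trans ?_ hr)
        have : 2 ^ S.card * (1 + 1) ≤ 2 ^ n := by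
          rw [show 2 ^ S.card * (1 + 1) = 2 ^ (S.card + 1) by ring]
          exact Nat.pow_le_pow_right two_pos hcard
        exact_mod_cast this
      obtain ⟨G', hc', hG', hp', hs'⟩ := exists_fold_coordinate K h (by exact_mod_cast hG1)
        ⟨R, hGs h hS⟩ (hGp h hS)
      refine ⟨G', fun s hs => hc' s (hGc _ ?_), fun z => ?_, fun k hk => ?_, fun k hk => ?_⟩
      · rw [Finset.card_insert_of_notMem hS] at hs
        rwa [show 2 ^ S.card * (2 * s + 1 + 1) = 2 ^ (S.card + 1) * (s + 1) by ring]
      · have h1 : sqOn S z h = z h := by simp [sqOn, hS]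
        rw [Finset.prod_insert hS, hGH z, hG', h1, smul_smul, sqOn_insert hS, mul_comm]
      · rw [Finset.mem_insert, not_or] at hk
        exact hp' k hk.1 _ (hGp k hk.2)
      · rw [Finset.mem_insert, not_or] at hk
        exact hs' k hk.1 _ (hGs k hk.2)
  obtain ⟨G, hGc, hGH, -, -⟩ := key Finset.univ
  refine ⟨G, fun s hs => hGc s (by simpa using hs), fun z => ?_⟩
  rw [hGH z]
  simp

end FoldCoordinate

end SliceFunctions

/-! ### Even and odd parts of analytic germs -/

namespace SliceFunctions

open MeasureTheory Filter Topology Set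
open scoped ContDiff NNReal ENNReal

section PowerSeries

variable {E F : Type*} [NormedAddCommGroup E] [NormedSpace ℝ E]
  [NormedAddCommGroup F] [NormedSpace ℝ F]

/-- A series of analytic functions with normally convergent power series is analytic. -/
theorem analyticAt_tsum [CompleteSpace F] {p : ℕ → FormalMultilinearSeries ℝ E F}
    {g : ℕ → E → F} {ρ : ℝ≥0} (hρ : 0 < ρ)
    (hs : Summable fun x : ℕ × ℕ => ‖p x.1 x.2‖ * (ρ : ℝ) ^ x.2)
    (hg : ∀ v ∈ Metric.ball (0 : E) ρ, ∀ j, HasSum (fun m => p j m fun _ => v) (g j v)) :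
    AnalyticAt ℝ (fun v => ∑' j, g j v) 0 := by
  have hs' : Summable fun x : ℕ × ℕ => ‖p x.2 x.1‖ * (ρ : ℝ) ^ x.1 :=
    (Equiv.prodComm ℕ ℕ).summable_iff.2 hs
  have hm : ∀ m, Summable fun j => ‖p j m‖ := fun m => by
    have := (hs'.prod_factor m).mul_right ((ρ : ℝ) ^ m)⁻¹
    refine this.congr fun j => ?_
    have : (ρ : ℝ) ^ m ≠ 0 := pow_ne_zero _ (NNReal.coe_ne_zero.2 hρ.ne')
    field_simp
  let q : FormalMultilinearSeries ℝ E F := fun m => ∑' j, p j m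
  have hq : (ρ : ℝ≥0∞) ≤ q.radius := by
    refine q.le_radius_of_summable_norm ?_
    refine Summable.of_nonneg_of_le (fun m => by positivity) (fun m => ?_) hs'.prod
    calc ‖∑' j, p j m‖ * (ρ : ℝ) ^ m ≤ (∑' j, ‖p j m‖) * (ρ : ℝ) ^ m := by
          gcongr
          exact norm_tsum_le_tsum_norm (hm m)
      _ = _ := tsum_mul_right.symm
  have hq0 : 0 < q.radius := (ENNReal.coe_pos.2 hρ).trans_le hq
  refine (q.hasFPowerSeriesOnBall hq0).analyticAt.congr ?_
  filter_upwards [Metric.ball_mem_nhds (0 : E) (NNReal.coe_pos.2 hρ)] with v hv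
  have hv' : ‖v‖ ≤ ρ := by simpa using (mem_ball_zero_iff.1 hv).le
  have hsum : Summable (Function.uncurry fun j m => p j m fun _ : Fin m => v) := by
    refine Summable.of_norm_bounded hs fun x => ?_
    refine ((p x.1 x.2).le_opNorm _).trans ?_
    simp only [Finset.prod_const, Finset.card_univ, Fintype.card_fin]
    gcongr
  calc q.sum v = ∑' m, ∑' j, p j m fun _ => v := by
        refine tsum_congr fun m => ?_
        exact (ContinuousMultilinearMap.apply ℝ (fun _ : Fin m => E) F fun _ => v).map_tsum
          (hm m).of_norm
    _ = ∑' j, ∑' m, p j m fun _ => v := hsum.tsum_comm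
    _ = ∑' j, g j v := tsum_congr fun j => (hg v hv j).tsum_eq

/-- The power series of the product of a function with the last coordinate. -/
noncomputable def mulSnd (p : FormalMultilinearSeries ℝ (E × ℝ) F) :
    FormalMultilinearSeries ℝ (E × ℝ) F
  | 0 => 0
  | m + 1 => ContinuousMultilinearMap.uncurryRight
      ((ContinuousLinearMap.smulRightL ℝ (E × ℝ) F
        (ContinuousLinearMap.snd ℝ E ℝ)).compContinuousMultilinearMap (p m))

theorem norm_mulSnd_succ_le (p : FormalMultilinearSeries ℝ (E × ℝ) F) (m : ℕ) :
    ‖mulSnd p (m + 1)‖ ≤ ‖p m‖ := by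
  refine (ContinuousMultilinearMap.uncurryRight_norm _).trans_le ?_
  refine ContinuousMultilinearMap.opNorm_le_bound (norm_nonneg _) fun v => ?_
  refine (ContinuousLinearMap.norm_smulRight_apply _ _).trans_le ?_
  refine (mul_le_of_le_one_left (norm_nonneg _) (ContinuousLinearMap.norm_snd_le ℝ E ℝ)).trans ?_
  exact (p m).le_opNorm v

theorem hasSum_mulSnd {p : FormalMultilinearSeries ℝ (E × ℝ) F} {v : E × ℝ} {a : F}
    (h : HasSum (fun m => p m fun _ => v) a) :
    HasSum (fun m => mulSnd p m fun _ => v) (v.2 • a) := by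
  rw [← hasSum_nat_add_iff' 1]
  have h0 : mulSnd p 0 = 0 := rfl
  simp only [Finset.range_one, Finset.sum_singleton, h0, zero_apply, sub_zero]
  exact h.const_smul v.2

theorem summable_mulSnd {p : FormalMultilinearSeries ℝ (E × ℝ) F} {ρ : ℝ} (hρ : 0 ≤ ρ)
    (h : Summable fun m => ‖p m‖ * ρ ^ m) :
    (Summable fun m => ‖mulSnd p m‖ * ρ ^ m) ∧
      ∑' m, ‖mulSnd p m‖ * ρ ^ m ≤ ρ * ∑' m, ‖p m‖ * ρ ^ m := by
  have hle : ∀ m, ‖mulSnd p (m + 1)‖ * ρ ^ (m + 1) ≤ ρ * (‖p m‖ * ρ ^ m) := fun m => by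
    have := mul_le_mul_of_nonneg_right (norm_mulSnd_succ_le p m) (pow_nonneg hρ (m + 1))
    rw [pow_succ] at this ⊢
    linarith
  have hs : Summable fun m => ‖mulSnd p (m + 1)‖ * ρ ^ (m + 1) :=
    Summable.of_nonneg_of_le (fun m => by positivity) hle (h.mul_left ρ)
  have hs' : Summable fun m => ‖mulSnd p m‖ * ρ ^ m := (summable_nat_add_iff 1).1 hs
  refine ⟨hs', ?_⟩
  rw [hs'.tsum_eq_zero_add]
  have h0 : mulSnd p 0 = 0 := rfl
  rw [h0, norm_zero, zero_mul, zero_add, ← tsum_mul_left]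
  exact hs.tsum_le_tsum hle (h.mul_left ρ)

/-- Each multiplication by the second coordinate gains a factor `ρ`; the resulting decay `ρ ^ j`
makes sums over `j` of such series converge. -/
theorem summable_iterate_mulSnd {p : FormalMultilinearSeries ℝ (E × ℝ) F} {ρ : ℝ} (hρ : 0 ≤ ρ)
    (h : Summable fun m => ‖p m‖ * ρ ^ m) (j : ℕ) :
    (Summable fun m => ‖mulSnd^[j] p m‖ * ρ ^ m) ∧
      ∑' m, ‖mulSnd^[j] p m‖ * ρ ^ m ≤ ρ ^ j * ∑' m, ‖p m‖ * ρ ^ m := by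
  induction j with
  | zero => simpa using h
  | succ j ih =>
    simp only [Function.iterate_succ_apply']
    have h1 := summable_mulSnd hρ ih.1
    refine ⟨h1.1, h1.2.trans ?_⟩
    calc _ ≤ ρ * (ρ ^ j * ∑' m, ‖p m‖ * ρ ^ m) := by gcongr; exact ih.2
      _ = _ := by ring

/-- Joint analyticity of `∑ k, u ^ k • g k y` at the origin, where `g k` is the sum of the series
`c k` and the `c k` satisfy a common Cauchy estimate. -/
theorem analyticAt_tsum_pow_smul [CompleteSpace F] {c : ℕ → FormalMultilinearSeries ℝ E F}
    {ρ : ℝ≥0} (hρ : 0 < ρ)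
    (hs : Summable fun x : ℕ × ℕ => ‖c x.1 x.2‖ * (ρ : ℝ) ^ (x.1 + x.2)) :
    AnalyticAt ℝ (fun p : E × ℝ => ∑' k, p.2 ^ k • (c k).sum p.1) 0 := by
  set d : ℕ → FormalMultilinearSeries ℝ (E × ℝ) F := fun k =>
    (c k).compContinuousLinearMap (ContinuousLinearMap.fst ℝ E ℝ) with hd
  have hρ' : (0 : ℝ) < ρ := hρ
  have hcs : ∀ k, Summable fun l => ‖c k l‖ * (ρ : ℝ) ^ l := fun k => by
    have := (hs.prod_factor k).mul_right ((ρ : ℝ) ^ k)⁻¹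
    refine this.congr fun j => ?_
    rw [pow_add]
    field_simp
  have hdc : ∀ k l, ‖d k l‖ ≤ ‖c k l‖ := fun k l => by
    refine (ContinuousMultilinearMap.norm_compContinuousLinearMap_le _ _).trans ?_
    refine mul_le_of_le_one_right (norm_nonneg _) ?_
    exact Finset.prod_le_one (fun _ _ => norm_nonneg _)
      fun _ _ => ContinuousLinearMap.norm_fst_le ℝ E ℝ
  have hds : ∀ k, Summable fun l => ‖d k l‖ * (ρ : ℝ) ^ l := fun k =>
    Summable.of_nonneg_of_le (fun l => by positivity)
      (fun l => by gcongr; exact hdc k l) (hcs k)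
  refine analyticAt_tsum (p := fun k => mulSnd^[k] (d k)) hρ ?_ ?_
  · rw [summable_prod_of_nonneg (fun x => by positivity)]
    refine ⟨fun k => (summable_iterate_mulSnd hρ'.le (hds k) k).1, ?_⟩
    refine Summable.of_nonneg_of_le (fun k => tsum_nonneg fun l => by positivity) (fun k => ?_)
      hs.prod
    refine (summable_iterate_mulSnd hρ'.le (hds k) k).2.trans ?_
    rw [← tsum_mul_left]
    refine ((hds k).mul_left _).tsum_le_tsum (fun l => ?_) (hs.prod_factor k)
    rw [pow_add]
    calc (ρ : ℝ) ^ k * (‖d k l‖ * ρ ^ l) ≤ ρ ^ k * (‖c k l‖ * ρ ^ l) := by gcongr; exact hdc k l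
      _ = _ := by ring
  · intro v hv k
    have hv1 : v.1 ∈ Metric.eball (0 : E) (c k).radius := by
      have h1 : (ρ : ℝ≥0∞) ≤ (c k).radius := (c k).le_radius_of_summable_norm (hcs k)
      refine Metric.eball_subset_eball h1 ?_
      rw [mem_eball_zero_iff]
      have h2 : ‖v.1‖ < ρ := (norm_fst_le v).trans_lt (mem_ball_zero_iff.1 hv)
      rw [enorm_eq_nnnorm]
      exact ENNReal.coe_lt_coe.2 h2
    have h3 : ∀ j, HasSum (fun m => mulSnd^[j] (d k) m fun _ => v) (v.2 ^ j • (c k).sum v.1) := by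
      intro j
      induction j with
      | zero =>
        simp only [Function.iterate_zero, id, pow_zero, one_smul]
        exact ((c k).summable hv1).hasSum
      | succ j ih =>
        simp only [Function.iterate_succ_apply']
        rw [pow_succ', mul_smul]
        exact hasSum_mulSnd ih
    exact h3 k

/-- The power series in `y` of the coefficient of `b ^ k` in the power series `p` in `(y, b)`. -/
noncomputable def sndCoeff (p : FormalMultilinearSeries ℝ (E × ℝ) F) (k : ℕ) :
    FormalMultilinearSeries ℝ E F := fun l =>
  ((ContinuousMultilinearMap.apply ℝ (fun _ : Fin k => E × ℝ) F
    fun _ => ((0 : E), (1 : ℝ))).compContinuousMultilinearMap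
      (p.changeOriginSeries k l)).compContinuousLinearMap
        fun _ => ContinuousLinearMap.inl ℝ E ℝ

theorem norm_sndCoeff_le (p : FormalMultilinearSeries ℝ (E × ℝ) F) (k l : ℕ) :
    ‖sndCoeff p k l‖ ≤ ‖p.changeOriginSeries k l‖ := by
  refine ContinuousMultilinearMap.opNorm_le_bound (norm_nonneg (p.changeOriginSeries k l))
    fun v => ?_
  refine ((p.changeOriginSeries k l (fun i => (v i, 0))).le_opNorm _).trans ?_
  have h1 : ∏ _i : Fin k, ‖((0 : E), (1 : ℝ))‖ = 1 := by simp [Prod.norm_def]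
  rw [h1, mul_one]
  refine ((p.changeOriginSeries k l).le_opNorm _).trans_eq ?_
  simp [Prod.norm_def]

theorem summable_sndCoeff {p : FormalMultilinearSeries ℝ (E × ℝ) F} {ρ : ℝ≥0}
    (hρ : (ρ : ℝ≥0∞) + ρ < p.radius) :
    Summable fun x : ℕ × ℕ => ‖sndCoeff p x.1 x.2‖ * (ρ : ℝ) ^ (x.1 + x.2) := by
  have h1 := ENNReal.tsum_coe_ne_top_iff_summable.2 (p.changeOriginSeries_summable_aux₁ hρ)
  have h2 : Summable fun x : ℕ × ℕ => ‖sndCoeff p x.1 x.2‖₊ * ρ ^ (x.1 + x.2) := by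
    rw [← ENNReal.tsum_coe_ne_top_iff_summable]
    refine ne_top_of_le_ne_top h1 ?_
    rw [ENNReal.tsum_prod', ENNReal.tsum_sigma']
    refine ENNReal.tsum_le_tsum fun k => ?_
    rw [ENNReal.tsum_sigma']
    refine ENNReal.tsum_le_tsum fun l => ?_
    rw [tsum_fintype, ← ENNReal.ofNNReal_finsetSum]
    refine ENNReal.coe_le_coe.2 ?_
    have h3 := p.nnnorm_changeOriginSeries_le_tsum k l
    rw [tsum_fintype] at h3
    have h4 : ‖sndCoeff p k l‖₊ ≤ ‖p.changeOriginSeries k l‖₊ := norm_sndCoeff_le p k l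
    calc ‖sndCoeff p k l‖₊ * ρ ^ (k + l) ≤ (∑ _s : {s : Finset (Fin (k + l)) // s.card = l},
          ‖p (k + l)‖₊) * ρ ^ (k + l) := by gcongr; exact h4.trans h3
      _ = _ := by
        rw [Finset.sum_mul]
        refine Finset.sum_congr rfl fun s _ => ?_
        ring
  refine (NNReal.summable_coe.2 h2).congr fun x => ?_
  simp

/-- Expansion of an analytic function of `(y, b)` in powers of `b`, obtained by changing the origin
to `(y, 0)`. -/
theorem sum_eq_tsum_sndCoeff [CompleteSpace F] {p : FormalMultilinearSeries ℝ (E × ℝ) F} {ρ : ℝ≥0}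
    (hρ : (ρ : ℝ≥0∞) + ρ < p.radius) {q : E × ℝ} (hq : q ∈ Metric.ball (0 : E × ℝ) ρ) :
    p.sum q = ∑' k, q.2 ^ k • (sndCoeff p k).sum q.1 := by
  have hq1 : ‖q.1‖₊ < ρ := (norm_fst_le q).trans_lt (mem_ball_zero_iff.1 hq)
  have hq2 : ‖q.2‖₊ < ρ := (norm_snd_le q).trans_lt (mem_ball_zero_iff.1 hq)
  have hn1 : ‖(q.1, (0 : ℝ))‖₊ = ‖q.1‖₊ := by simp [Prod.nnnorm_def]
  have hn2 : ‖((0 : E), q.2)‖₊ = ‖q.2‖₊ := by simp [Prod.nnnorm_def]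
  have h2 : q = (q.1, (0 : ℝ)) + ((0 : E), q.2) := by simp
  have h3 := p.changeOrigin_eval (x := (q.1, (0 : ℝ))) (y := ((0 : E), q.2)) (by
    rw [hn1, hn2]
    exact (ENNReal.add_lt_add (ENNReal.coe_lt_coe.2 hq1) (ENNReal.coe_lt_coe.2 hq2)).trans hρ)
  conv_lhs => rw [h2]
  rw [← h3]
  refine tsum_congr fun k => ?_
  have h4 : (fun _ : Fin k => ((0 : E), q.2)) = fun i : Fin k => q.2 • ((0 : E), (1 : ℝ)) := by
    simp
  rw [h4, ContinuousMultilinearMap.map_smul_univ]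
  simp only [Finset.prod_const, Finset.card_univ, Fintype.card_fin]
  congr 1
  have h5 : (q.1, (0 : ℝ)) ∈ Metric.eball (0 : E × ℝ) (p.changeOriginSeries k).radius := by
    rw [mem_eball_zero_iff, enorm_eq_nnnorm, hn1]
    refine (ENNReal.coe_lt_coe.2 hq1).trans (lt_of_lt_of_le ?_
      (p.le_changeOriginSeries_radius k))
    exact lt_of_le_of_lt le_self_add hρ
  exact (ContinuousMultilinearMap.apply ℝ (fun _ : Fin k => E × ℝ) F
    fun _ => ((0 : E), (1 : ℝ))).map_tsum ((p.changeOriginSeries k).summable h5)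

theorem summable_pow_smul_sum [CompleteSpace F] {c : ℕ → FormalMultilinearSeries ℝ E F} {ρ : ℝ≥0}
    (hs : Summable fun x : ℕ × ℕ => ‖c x.1 x.2‖ * (ρ : ℝ) ^ (x.1 + x.2)) {q : E × ℝ}
    (hq : q ∈ Metric.ball (0 : E × ℝ) ρ) : Summable fun k => q.2 ^ k • (c k).sum q.1 := by
  refine Summable.of_norm_bounded hs.prod fun k => ?_
  have h2 : ∀ l, ‖q.2 ^ k • c k l fun _ => q.1‖ ≤ ‖c k l‖ * (ρ : ℝ) ^ (k + l) := fun l => by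
    rw [norm_smul, norm_pow]
    have h3 := (c k l).le_opNorm fun _ => q.1
    simp only [Finset.prod_const, Finset.card_univ, Fintype.card_fin] at h3
    have h4 : ‖q.2‖ ≤ ρ := (norm_snd_le q).trans (mem_ball_zero_iff.1 hq).le
    have h5 : ‖q.1‖ ≤ ρ := (norm_fst_le q).trans (mem_ball_zero_iff.1 hq).le
    calc ‖q.2‖ ^ k * ‖c k l fun _ => q.1‖ ≤ ρ ^ k * (‖c k l‖ * ρ ^ l) := by
          gcongr
          exact h3.trans (by gcongr)
      _ = _ := by rw [pow_add]; ring
  have h6 : q.2 ^ k • (c k).sum q.1 = ∑' l, q.2 ^ k • c k l fun _ => q.1 :=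
    (tsum_const_smul'' _).symm
  rw [h6]
  exact tsum_of_norm_bounded (hs.prod_factor k).hasSum h2

/-- Whitney's theorem for analytic germs: separating the even and odd powers of `b` in the power
series of `H` gives `H(y, b) = G₀(y, b²) + b G₁(y, b²)` with `G₀` and `G₁` analytic. -/
theorem exists_analyticAt_even_odd [CompleteSpace F] {H : E × ℝ → F} (hH : AnalyticAt ℝ H 0) :
    ∃ G₀ G₁ : E × ℝ → F, AnalyticAt ℝ G₀ 0 ∧ AnalyticAt ℝ G₁ 0 ∧
      ∀ᶠ p in 𝓝 (0 : E × ℝ), H p = G₀ (p.1, p.2 ^ 2) + p.2 • G₁ (p.1, p.2 ^ 2) := by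
  obtain ⟨p, r, hp⟩ := hH
  obtain ⟨ρ, hρ0, hρr, hρ1⟩ : ∃ ρ : ℝ≥0, 0 < ρ ∧ (ρ : ℝ≥0∞) + ρ < r ∧ ρ ≤ 1 := by
    obtain ⟨a, ha0, har⟩ := ENNReal.lt_iff_exists_nnreal_btwn.1 hp.r_pos
    have ha0' : 0 < a := ENNReal.coe_pos.1 ha0
    refine ⟨min (a / 2) 1, lt_min (half_pos ha0') one_pos, lt_of_le_of_lt ?_ har, min_le_right _ _⟩
    rw [← ENNReal.coe_add]
    refine ENNReal.coe_le_coe.2 ?_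
    calc min (a / 2) 1 + min (a / 2) 1 ≤ a / 2 + a / 2 := by gcongr <;> exact min_le_left _ _
      _ = a := add_halves a
  have hρp : (ρ : ℝ≥0∞) + ρ < p.radius := hρr.trans_le hp.r_le
  have hρ0' : (0 : ℝ) < ρ := hρ0
  have hρ1' : (ρ : ℝ) ≤ 1 := hρ1
  have hsum := summable_sndCoeff hρp
  have hsub : ∀ δ : ℕ, δ ≤ 1 → AnalyticAt ℝ
      (fun q : E × ℝ => ∑' j, q.2 ^ j • (sndCoeff p (2 * j + δ)).sum q.1) 0 := by
    intro δ hδ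
    refine analyticAt_tsum_pow_smul (c := fun j => sndCoeff p (2 * j + δ)) (ρ := ρ ^ 2)
      (pow_pos hρ0 2) ?_
    have hinj : Function.Injective fun x : ℕ × ℕ => (2 * x.1 + δ, x.2) := by
      rintro ⟨a, b⟩ ⟨a', b'⟩ h
      simp only [Prod.mk.injEq] at h ⊢
      omega
    refine Summable.of_nonneg_of_le (fun x => by positivity) (fun x => ?_)
      ((hsum.comp_injective hinj).mul_left (ρ : ℝ)⁻¹)
    rw [inv_mul_eq_div, le_div_iff₀ hρ0']
    simp only [Function.comp_apply, mul_assoc]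
    gcongr
    push_cast
    rw [← pow_mul, ← pow_succ]
    exact pow_le_pow_of_le_one hρ0'.le hρ1' (by omega)
  refine ⟨_, _, hsub 0 zero_le_one, hsub 1 le_rfl, ?_⟩
  filter_upwards [Metric.ball_mem_nhds (0 : E × ℝ) hρ0'] with q hq
  have hqs := summable_pow_smul_sum hsum hq
  have hqr : q ∈ Metric.eball (0 : E × ℝ) r := by
    rw [mem_eball_zero_iff, enorm_eq_nnnorm]
    have : ‖q‖₊ < ρ := mem_ball_zero_iff.1 hq
    exact (ENNReal.coe_lt_coe.2 this).trans (lt_of_le_of_lt le_self_add hρr)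
  have hqH := hp.sum hqr
  rw [zero_add, sum_eq_tsum_sndCoeff hρp hq] at hqH
  have he : Summable fun j => q.2 ^ (2 * j) • (sndCoeff p (2 * j)).sum q.1 :=
    hqs.comp_injective (i := fun j => 2 * j) fun a b h => by simpa using h
  have ho : Summable fun j => q.2 ^ (2 * j + 1) • (sndCoeff p (2 * j + 1)).sum q.1 :=
    hqs.comp_injective (i := fun j => 2 * j + 1) fun a b h => by simpa using h
  rw [hqH, ← tsum_even_add_odd (f := fun k => q.2 ^ k • (sndCoeff p k).sum q.1) he ho]
  congr 1
  · simp only [pow_mul, add_zero]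
  · rw [← tsum_const_smul'']
    refine tsum_congr fun j => ?_
    rw [smul_smul, ← pow_mul, pow_succ']

end PowerSeries

end SliceFunctions

/-! ### Folding the coordinates of an analytic function -/

namespace SliceFunctions

open MeasureTheory Filter Topology Set
open scoped ContDiff

section Identity

variable {E F : Type*} [NormedAddCommGroup E] [NormedSpace ℝ E]
  [NormedAddCommGroup F] [NormedSpace ℝ F] [CompleteSpace F]

/-- Identity theorem for germs: an analytic germ vanishing on an open set which accumulates at the
base point is zero. -/
theorem eventually_eq_zero_of_mem_closure {f : E → F} {p : E} (hf : AnalyticAt ℝ f p) {O : Set E}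
    (hO : IsOpen O) (hp : p ∈ closure O) (h : ∀ᶠ x in 𝓝 p, x ∈ O → f x = 0) :
    ∀ᶠ x in 𝓝 p, f x = 0 := by
  obtain ⟨r, hr, hfr⟩ := hf.exists_ball_analyticOnNhd
  obtain ⟨r', hr', hfr'⟩ := Metric.eventually_nhds_iff_ball.1 h
  set s := min r r' with hs
  have hs0 : 0 < s := lt_min hr hr'
  obtain ⟨x, hxO, hx⟩ := Metric.mem_closure_iff.1 hp s hs0
  have hxs : x ∈ Metric.ball p s := by rwa [Metric.mem_ball, dist_comm]
  have h1 : f =ᶠ[𝓝 x] 0 := by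
    filter_upwards [hO.mem_nhds hxO, Metric.isOpen_ball.mem_nhds hxs] with y hy hys
    exact hfr' y (Metric.ball_subset_ball (min_le_right _ _) hys) hy
  have hfs := hfr.mono (Metric.ball_subset_ball (min_le_left r r'))
  have h2 := hfs.eqOn_of_preconnected_of_eventuallyEq
    (g := 0) (fun _ _ => analyticAt_const) (convex_ball p s).isPreconnected hxs h1
  filter_upwards [Metric.ball_mem_nhds p hs0] with y hy using h2 hy

/-- Analytic germs at the points of `S` which agree, on an open set `O` adherent to all points of
`S`, with one function `g`, are the germs of one analytic function. -/
theorem exists_analyticOnNhd_of_germs {S O : Set E} (hO : IsOpen O) (hS : S ⊆ closure O)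
    {Φ : E → E → F} (hΦ : ∀ p ∈ S, AnalyticAt ℝ (Φ p) p) {g : E → F}
    (hg : ∀ p ∈ S, ∀ᶠ x in 𝓝 p, x ∈ O → Φ p x = g x) :
    ∃ (U : Set E) (G : E → F), IsOpen U ∧ S ⊆ U ∧ AnalyticOnNhd ℝ G U ∧ ∀ p ∈ S, G p = Φ p p := by
  have hex : ∀ p ∈ S, ∃ r : ℝ, 0 < r ∧ AnalyticOnNhd ℝ (Φ p) (Metric.ball p r) ∧
      ∀ x ∈ Metric.ball p r, x ∈ O → Φ p x = g x := by
    intro p hp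
    obtain ⟨r, hr, h1⟩ := (hΦ p hp).exists_ball_analyticOnNhd
    obtain ⟨r', hr', h2⟩ := Metric.eventually_nhds_iff_ball.1 (hg p hp)
    exact ⟨min r r', lt_min hr hr', h1.mono (Metric.ball_subset_ball (min_le_left _ _)),
      fun x hx => h2 x (Metric.ball_subset_ball (min_le_right _ _) hx)⟩
  choose! r hr0 hra hrg using hex
  -- with halved radii, one of the centres of two intersecting balls lies in the other full ball
  have agree' : ∀ p ∈ S, ∀ q ∈ S, q ∈ Metric.ball p (r p) →
      EqOn (Φ p) (Φ q) (Metric.ball p (r p) ∩ Metric.ball q (r q)) := by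
    intro p hp q hq hqp
    have hB : IsOpen (Metric.ball p (r p) ∩ Metric.ball q (r q)) :=
      Metric.isOpen_ball.inter Metric.isOpen_ball
    obtain ⟨x, hxB, hxO⟩ := mem_closure_iff.1 (hS hq) _ hB ⟨hqp, Metric.mem_ball_self (hr0 q hq)⟩
    refine ((hra p hp).mono inter_subset_left).eqOn_of_preconnected_of_eventuallyEq
      ((hra q hq).mono inter_subset_right)
      ((convex_ball p (r p)).inter (convex_ball q (r q))).isPreconnected hxB ?_
    filter_upwards [(hB.inter hO).mem_nhds ⟨hxB, hxO⟩] with y hy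
    rw [hrg p hp y hy.1.1 hy.2, hrg q hq y hy.1.2 hy.2]
  have agree : ∀ p ∈ S, ∀ q ∈ S, ∀ x ∈ Metric.ball p (r p / 2), x ∈ Metric.ball q (r q / 2) →
      Φ p x = Φ q x := by
    intro p hp q hq x hxp hxq
    have hd : dist p q < r p / 2 + r q / 2 :=
      (dist_triangle_left p q x).trans_lt (add_lt_add hxp hxq)
    have hxp' := Metric.ball_subset_ball (half_le_self (hr0 p hp).le) hxp
    have hxq' := Metric.ball_subset_ball (half_le_self (hr0 q hq).le) hxq
    rcases le_total (r p) (r q) with hle | hle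
    · refine (agree' q hq p hp ?_ ⟨hxq', hxp'⟩).symm
      rw [Metric.mem_ball]; linarith
    · refine agree' p hp q hq ?_ ⟨hxp', hxq'⟩
      rw [Metric.mem_ball, dist_comm]; linarith
  classical
  let U : Set E := ⋃ p ∈ S, Metric.ball p (r p / 2)
  let c : E → E := fun x => if hx : ∃ p ∈ S, x ∈ Metric.ball p (r p / 2) then hx.choose else x
  have hG : ∀ p ∈ S, ∀ x ∈ Metric.ball p (r p / 2), Φ (c x) x = Φ p x := by
    intro p hp x hx
    have hx' : ∃ p ∈ S, x ∈ Metric.ball p (r p / 2) := ⟨p, hp, hx⟩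
    have hc : c x = hx'.choose := dif_pos hx'
    rw [hc]
    exact agree _ hx'.choose_spec.1 p hp x hx'.choose_spec.2 hx
  refine ⟨U, fun x => Φ (c x) x, isOpen_biUnion fun _ _ => Metric.isOpen_ball,
    fun p hp => mem_biUnion hp (Metric.mem_ball_self (half_pos (hr0 p hp))), fun x hx => ?_,
    fun p hp => hG p hp p (Metric.mem_ball_self (half_pos (hr0 p hp)))⟩
  obtain ⟨p, hp, hx⟩ := mem_iUnion₂.1 hx
  refine (hra p hp x (Metric.ball_subset_ball (half_le_self (hr0 p hp).le) hx)).congr ?_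
  filter_upwards [Metric.isOpen_ball.mem_nhds hx] with y hy using (hG p hp y hy).symm

end Identity

section AnalyticCoordinate

variable {n : ℕ}

/-- The point `w` with the imaginary parts replaced by their square roots. -/
noncomputable def sqrtIm (w : Fin n → ℂ) : Fin n → ℂ := fun k => ⟨(w k).re, √(w k).im⟩

theorem continuous_complex_mk {X : Type*} [TopologicalSpace X] {a b : X → ℝ} (ha : Continuous a)
    (hb : Continuous b) : Continuous fun x => (⟨a x, b x⟩ : ℂ) := by
  have : (fun x => (⟨a x, b x⟩ : ℂ)) = fun x => (a x : ℂ) + b x * Complex.I := by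
    funext x; apply Complex.ext <;> simp
  rw [this]
  fun_prop

theorem continuous_sqrtIm : Continuous (sqrtIm (n := n)) :=
  continuous_pi fun k => continuous_complex_mk (by fun_prop) (by fun_prop)

theorem continuous_sqOn (S : Finset (Fin n)) : Continuous (sqOn S) := by
  refine continuous_pi fun k => ?_
  unfold sqOn
  split_ifs
  · exact continuous_complex_mk (by fun_prop) (by fun_prop)
  · fun_prop

theorem sqrtIm_sqOn {z : Fin n → ℂ} (hz : ∀ h, 0 ≤ (z h).im) :
    sqrtIm (sqOn Finset.univ z) = z := by
  funext k
  simp [sqrtIm, sqOn, Real.sqrt_sq (hz k)]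

theorem sqOn_sqrtIm {w : Fin n → ℂ} (hw : ∀ h, 0 ≤ (w h).im) :
    sqOn Finset.univ (sqrtIm w) = w := by
  funext k
  simp [sqrtIm, sqOn, Real.sq_sqrt (hw k)]

theorem mem_closure_im_pos (S : Finset (Fin n)) {w : Fin n → ℂ} (hw : ∀ h ∈ S, 0 ≤ (w h).im) :
    w ∈ closure {w : Fin n → ℂ | ∀ h ∈ S, 0 < (w h).im} := by
  have h1 : Tendsto (fun t : ℝ => fun h => w h + t * Complex.I) (𝓝[>] 0) (𝓝 w) := by
    have h2 : Continuous fun t : ℝ => fun h => w h + t * Complex.I := by fun_prop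
    have h3 := (h2.tendsto 0).mono_left (nhdsWithin_le_nhds (s := Ioi 0))
    simpa using h3
  refine mem_closure_of_tendsto h1 ?_
  filter_upwards [self_mem_nhdsWithin] with t ht h hh
  have := hw h hh
  have ht' : 0 < t := ht
  simp
  linarith

theorem isOpen_im_pos (S : Finset (Fin n)) : IsOpen {w : Fin n → ℂ | ∀ h ∈ S, 0 < (w h).im} := by
  have : {w : Fin n → ℂ | ∀ h ∈ S, 0 < (w h).im} = ⋂ h ∈ S, {w | 0 < (w h).im} := by
    ext; simp
  rw [this]
  exact isOpen_biInter_finset fun h _ => isOpen_lt continuous_const (by fun_prop)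

theorem contDiff_conjAt (k : Fin n) {m : WithTop ℕ∞} :
    ContDiff ℝ m (conjAt k : (Fin n → ℂ) → Fin n → ℂ) := by
  refine contDiff_pi.2 fun j => ?_
  by_cases hj : j = k
  · subst hj
    have : (fun z : Fin n → ℂ => conjAt j z j) = fun z => Complex.conjCLE (z j) := by
      funext z; simp [conjAt]
    rw [this]
    fun_prop
  · simp only [conjAt, Function.update_of_ne hj]
    fun_prop

theorem conjAt_of_im_eq_zero {k : Fin n} {z : Fin n → ℂ} (hz : (z k).im = 0) : conjAt k z = z := by
  have : (starRingEnd ℂ) (z k) = z k := Complex.conj_eq_iff_im.2 hz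
  simp [conjAt, this]

variable {F : Type*} [NormedAddCommGroup F] [NormedSpace ℝ F] [CompleteSpace F]

theorem contDiff_setIm_comp (h : Fin n) {m : WithTop ℕ∞} {f : ℝ → ℝ} {z : Fin n → ℂ}
    (hf : ContDiffAt ℝ m f (z h).im) : ContDiffAt ℝ m (fun w => setIm h w (f (w h).im)) z := by
  have h1 : ContDiffAt ℝ m (fun w : Fin n → ℂ => (w h).im) z :=
    (Complex.imCLM.contDiff.comp (contDiff_apply ℝ ℂ h)).contDiffAt
  exact (contDiff_setIm h).contDiffAt.comp z (contDiffAt_id.prodMk (hf.comp z h1))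

theorem continuous_setIm_comp (h : Fin n) {f : ℝ → ℝ} (hf : Continuous f) :
    Continuous fun z : Fin n → ℂ => setIm h z (f (z h).im) := by
  have h1 : Continuous fun z : Fin n → ℂ => (z, f (z h).im) := by fun_prop
  exact (contDiff_setIm h (m := 0)).continuous.comp h1

/-- The analytic counterpart of `exists_fold_coordinate` at a point `z₀` with `0 ≤ (z₀ h).im`. -/
theorem exists_analyticAt_fold_coordinate (K : Finset (Fin n)) (h : Fin n) {H : (Fin n → ℂ) → F}
    {z₀ : Fin n → ℂ} (hH : AnalyticAt ℝ H z₀) (hz₀ : 0 ≤ (z₀ h).im)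
    (hp : (z₀ h).im = 0 → ∀ᶠ z in 𝓝 z₀, H (conjAt h z) = paritySign K h • H z) :
    ∃ G : (Fin n → ℂ) → F, AnalyticAt ℝ G (setIm h z₀ ((z₀ h).im ^ 2)) ∧
      ∀ᶠ z in 𝓝 z₀, H z = (if h ∈ K then (z h).im else 1) • G (setIm h z ((z h).im ^ 2)) := by
  have him : Continuous fun z : Fin n → ℂ => (z h).im := by fun_prop
  rcases hz₀.lt_or_eq with hpos | hzero
  · have hne : (setIm h z₀ ((z₀ h).im ^ 2) h).im ≠ 0 := by simp [setIm, hpos.ne']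
    have hsq : ContDiffAt ℝ ω Real.sqrt (setIm h z₀ ((z₀ h).im ^ 2) h).im :=
      Real.contDiffAt_sqrt hne
    have hroot : setIm h (setIm h z₀ ((z₀ h).im ^ 2)) √(setIm h z₀ ((z₀ h).im ^ 2) h).im = z₀ := by
      rw [setIm_setIm]
      simp [setIm, Real.sqrt_sq hpos.le]
    refine ⟨fun w => (if h ∈ K then (√(w h).im)⁻¹ else 1) • H (setIm h w √(w h).im), ?_, ?_⟩
    · refine AnalyticAt.smul ?_ ?_
      · split_ifs
        · refine ContDiffAt.analyticAt (ContDiffAt.inv ?_ ?_)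
          · exact hsq.comp (f := fun w : Fin n → ℂ => (w h).im) _
              (Complex.imCLM.contDiff.comp (contDiff_apply ℝ ℂ h)).contDiffAt
          · rw [Real.sqrt_ne_zero']
            simpa [setIm] using pow_pos hpos 2
        · exact analyticAt_const
      · refine AnalyticAt.fun_comp ?_ (ContDiffAt.analyticAt (contDiff_setIm_comp h hsq))
        rwa [hroot]
    · filter_upwards [(isOpen_lt continuous_const him).mem_nhds hpos] with z hz
      have hz' : 0 < (z h).im := hz
      have h1 : √(setIm h z ((z h).im ^ 2) h).im = (z h).im := by
        simp [setIm, Real.sqrt_sq hz'.le]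
      rw [h1, setIm_setIm, setIm_self, smul_smul]
      split_ifs
      · rw [mul_inv_cancel₀ hz'.ne', one_smul]
      · simp
  · have hz0' : setIm h z₀ 0 = z₀ := by
      conv_rhs => rw [← setIm_self h z₀, ← hzero]
    have hH' : AnalyticAt ℝ (fun p : (Fin n → ℂ) × ℝ => H (setIm h (z₀ + p.1) p.2)) 0 := by
      refine AnalyticAt.fun_comp (g := H) ?_ (ContDiffAt.analyticAt ?_)
      · simpa [hz0'] using hH
      · exact (contDiff_setIm h).contDiffAt.comp _
          ((contDiffAt_const.add contDiffAt_fst).prodMk contDiffAt_snd)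
    obtain ⟨G₀, G₁, hG₀, hG₁, hG⟩ := exists_analyticAt_even_odd hH'
    have hlim : Tendsto (fun z : Fin n → ℂ => (setIm h z ((z h).im ^ 2) - z₀, (z h).im)) (𝓝 z₀)
        (𝓝 0) := by
      have h1 : Continuous fun z : Fin n → ℂ => (setIm h z ((z h).im ^ 2) - z₀, (z h).im) :=
        ((continuous_setIm_comp h (continuous_pow 2)).sub continuous_const).prodMk him
      have h2 := h1.tendsto z₀
      simp only [← hzero] at h2
      simpa [hz0', ← Prod.zero_eq_mk] using h2
    have hsplit : ∀ᶠ z in 𝓝 z₀, H z =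
        G₀ (setIm h z ((z h).im ^ 2) - z₀, (z h).im ^ 2) +
          (z h).im • G₁ (setIm h z ((z h).im ^ 2) - z₀, (z h).im ^ 2) := by
      filter_upwards [hlim.eventually hG] with z hz
      simpa [setIm_setIm, setIm_self] using hz
    have hconj : ∀ᶠ z in 𝓝 z₀, H (conjAt h z) =
        G₀ (setIm h z ((z h).im ^ 2) - z₀, (z h).im ^ 2) -
          (z h).im • G₁ (setIm h z ((z h).im ^ 2) - z₀, (z h).im ^ 2) := by
      have h1 := (contDiff_conjAt h (m := 0)).continuous.tendsto z₀
      rw [conjAt_of_im_eq_zero hzero.symm] at h1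
      filter_upwards [h1.eventually hsplit] with z hz
      have h2 : ∀ b, setIm h (conjAt h z) b = setIm h z b := fun b => by simp [setIm, conjAt]
      have h3 : (conjAt h z h).im = -(z h).im := by simp [conjAt]
      rw [hz, h2, h3, neg_sq, neg_smul, ← sub_eq_add_neg]
    have hA : ∀ {G : (Fin n → ℂ) × ℝ → F}, AnalyticAt ℝ G 0 →
        AnalyticAt ℝ (fun w => G (w - z₀, (w h).im)) (setIm h z₀ ((z₀ h).im ^ 2)) := by
      intro G hGa
      refine AnalyticAt.fun_comp (g := G) ?_ (ContDiffAt.analyticAt ?_)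
      · have : (setIm h z₀ 0 h).im = 0 := by simp [setIm]
        simpa [← hzero, hz0', this, ← Prod.zero_eq_mk] using hGa
      · exact (contDiffAt_id.sub contDiffAt_const).prodMk
          (Complex.imCLM.contDiff.comp (contDiff_apply ℝ ℂ h)).contDiffAt
    have him2 : ∀ z : Fin n → ℂ, (setIm h z ((z h).im ^ 2) h).im = (z h).im ^ 2 := fun z => by
      simp [setIm]
    by_cases hK : h ∈ K
    · refine ⟨_, hA hG₁, ?_⟩
      filter_upwards [hsplit, hconj, hp hzero.symm] with z h1 h2 h3
      simp only [him2, if_pos hK]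
      rw [paritySign, if_pos hK, neg_one_smul, h2] at h3
      have h4 : (2 : ℝ) • H z =
          (2 : ℝ) • (z h).im • G₁ (setIm h z ((z h).im ^ 2) - z₀, (z h).im ^ 2) := by
        rw [two_smul, two_smul]
        nth_rewrite 2 [← neg_neg (H z)]
        rw [← h3, h1]
        abel
      exact smul_right_injective F two_ne_zero h4
    · refine ⟨_, hA hG₀, ?_⟩
      filter_upwards [hsplit, hconj, hp hzero.symm] with z h1 h2 h3
      simp only [him2, if_neg hK, one_smul]
      rw [paritySign, if_neg hK, one_smul, h2] at h3
      have h4 : (2 : ℝ) • H z =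
          (2 : ℝ) • G₀ (setIm h z ((z h).im ^ 2) - z₀, (z h).im ^ 2) := by
        rw [two_smul, two_smul]
        nth_rewrite 2 [← h3]
        rw [h1]
        abel
      exact smul_right_injective F two_ne_zero h4

/-- The symmetry of `H` in another coordinate passes to the folded function, by the identity
theorem: the points with positive imaginary part of the `h`-th coordinate are squares. -/
theorem eventually_conjAt_of_fold {K : Finset (Fin n)} {h k : Fin n} (hk : k ≠ h)
    {H G : (Fin n → ℂ) → F} {z₀ : Fin n → ℂ} (hz₀ : 0 ≤ (z₀ h).im) (hk₀ : (z₀ k).im = 0) {c : ℝ}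
    (hG : AnalyticAt ℝ G (setIm h z₀ ((z₀ h).im ^ 2)))
    (hHG : ∀ᶠ z in 𝓝 z₀, H z = (if h ∈ K then (z h).im else 1) • G (setIm h z ((z h).im ^ 2)))
    (hp : ∀ᶠ z in 𝓝 z₀, H (conjAt k z) = c • H z) :
    ∀ᶠ w in 𝓝 (setIm h z₀ ((z₀ h).im ^ 2)), G (conjAt k w) = c • G w := by
  set w₀ := setIm h z₀ ((z₀ h).im ^ 2) with hw₀
  have hk₀' : (w₀ k).im = 0 := by simp [hw₀, setIm, Function.update_of_ne hk, hk₀]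
  have hf : AnalyticAt ℝ (fun w => G (conjAt k w) - c • G w) w₀ := by
    refine AnalyticAt.sub (AnalyticAt.fun_comp ?_ (contDiff_conjAt k).contDiffAt.analyticAt)
      (analyticAt_const.smul hG)
    rwa [conjAt_of_im_eq_zero hk₀']
  have hroot : Tendsto (fun w : Fin n → ℂ => setIm h w √(w h).im) (𝓝 w₀) (𝓝 z₀) := by
    have h1 : Continuous fun w : Fin n → ℂ => setIm h w √(w h).im :=
      continuous_setIm_comp h Real.continuous_sqrt
    have h2 := h1.tendsto w₀
    have h3 : setIm h w₀ √(w₀ h).im = z₀ := by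
      rw [hw₀, setIm_setIm]
      simp [setIm, Real.sqrt_sq hz₀]
    rwa [h3] at h2
  have hconj : Tendsto (conjAt k) (𝓝 z₀) (𝓝 z₀) := by
    have h1 := (contDiff_conjAt k (m := 0)).continuous.tendsto z₀
    rwa [conjAt_of_im_eq_zero hk₀] at h1
  have hcl : w₀ ∈ closure {w : Fin n → ℂ | ∀ j ∈ ({h} : Finset (Fin n)), 0 < (w j).im} := by
    refine mem_closure_im_pos {h} ?_
    intro j hj
    rw [Finset.mem_singleton.1 hj]
    simp [hw₀, setIm, sq_nonneg]
  have := eventually_eq_zero_of_mem_closure hf (isOpen_im_pos {h}) hcl ?_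
  · filter_upwards [this] with w hw using sub_eq_zero.1 hw
  · filter_upwards [hroot.eventually hHG, hroot.eventually (hconj.eventually hHG),
      hroot.eventually hp] with w h1 h2 h3 hw
    have hpos : 0 < (w h).im := hw h (Finset.mem_singleton_self h)
    have h4 : ∀ v : Fin n → ℂ, (setIm h v √(w h).im h).im = √(w h).im := fun v => by simp [setIm]
    rw [conjAt_setIm_of_ne hk] at h2 h3
    have h5 : (conjAt k w h).im = (w h).im := by simp [conjAt, Function.update_of_ne hk.symm]
    rw [h4, setIm_setIm, Real.sq_sqrt hpos.le, setIm_self] at h1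
    rw [h4, setIm_setIm, Real.sq_sqrt hpos.le] at h2
    rw [← h5, setIm_self, h5] at h2
    rw [← h5] at h3
    rw [h5, h2, h1, smul_comm c] at h3
    have hne : (if h ∈ K then √(w h).im else 1) ≠ 0 := by
      split_ifs
      · exact (Real.sqrt_pos.2 hpos).ne'
      · exact one_ne_zero
    exact sub_eq_zero.2 (smul_right_injective F hne h3)

/-- The analytic counterpart of `exists_contDiff_sqOn`, for germs at a point whose coordinates have
nonnegative imaginary parts. -/
theorem exists_analyticAt_sqOn (K : Finset (Fin n)) {H : (Fin n → ℂ) → F} {z₀ : Fin n → ℂ}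
    (hH : AnalyticAt ℝ H z₀) (hz₀ : ∀ h, 0 ≤ (z₀ h).im)
    (hp : ∀ k, (z₀ k).im = 0 → ∀ᶠ z in 𝓝 z₀, H (conjAt k z) = paritySign K k • H z) :
    ∃ G : (Fin n → ℂ) → F, AnalyticAt ℝ G (sqOn Finset.univ z₀) ∧
      ∀ᶠ z in 𝓝 z₀, H z = (∏ k ∈ K, (z k).im) • G (sqOn Finset.univ z) := by
  have key : ∀ S : Finset (Fin n), ∃ G : (Fin n → ℂ) → F, AnalyticAt ℝ G (sqOn S z₀) ∧
      (∀ᶠ z in 𝓝 z₀, H z = (∏ k ∈ S, if k ∈ K then (z k).im else 1) • G (sqOn S z)) ∧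
      ∀ k ∉ S, (z₀ k).im = 0 →
        ∀ᶠ w in 𝓝 (sqOn S z₀), G (conjAt k w) = paritySign K k • G w := by
    intro S
    induction S using Finset.induction_on with
    | empty =>
      have h1 : ∀ z : Fin n → ℂ, sqOn ∅ z = z := fun z => by funext k; simp [sqOn]
      exact ⟨H, by rwa [h1], by simp [h1], by simpa [h1] using hp⟩
    | insert h S hS ih =>
      obtain ⟨G, hGa, hGH, hGp⟩ := ih
      have h1 : ∀ z : Fin n → ℂ, ∀ k ∉ S, sqOn S z k = z k := fun z k hk => by simp [sqOn, hk]
      have h2 : 0 ≤ (sqOn S z₀ h).im := by rw [h1 _ _ hS]; exact hz₀ h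
      obtain ⟨G', hGa', hGG'⟩ := exists_analyticAt_fold_coordinate K h hGa h2
        (fun h0 => hGp h hS (by rwa [h1 _ _ hS] at h0))
      have h3 : ∀ z, setIm h (sqOn S z) ((sqOn S z h).im ^ 2) = sqOn (insert h S) z := fun z => by
        rw [sqOn_insert hS, h1 _ _ hS]
      refine ⟨G', by rwa [h3] at hGa', ?_, fun k hk hk0 => ?_⟩
      · filter_upwards [hGH, ((continuous_sqOn S).tendsto z₀).eventually hGG'] with z hz1 hz2
        rw [hz1, hz2, h3, h1 _ _ hS, smul_smul, Finset.prod_insert hS, mul_comm]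
      · rw [Finset.mem_insert, not_or] at hk
        rw [← h3]
        exact eventually_conjAt_of_fold hk.1 h2 (by rwa [h1 _ _ hk.2]) hGa' hGG' (hGp k hk.2 hk0)
  obtain ⟨G, hGa, hGH, -⟩ := key Finset.univ
  refine ⟨G, hGa, ?_⟩
  filter_upwards [hGH] with z hz
  rw [hz]
  simp

/-- The global version of `exists_analyticAt_sqOn`. A point `z` with nonnegative imaginary parts is
determined by `sqOn univ z`, so the local quotients are germs indexed by a set of points, and they
glue to one analytic function. -/
theorem exists_analyticOnNhd_sqOn (K : Finset (Fin n)) {H : (Fin n → ℂ) → F} {D : Set (Fin n → ℂ)}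
    (hD : IsOpen D) (hH : AnalyticOnNhd ℝ H D)
    (hp : ∀ z ∈ D, ∀ k, H (conjAt k z) = paritySign K k • H z) :
    ∃ (U : Set (Fin n → ℂ)) (G : (Fin n → ℂ) → F), IsOpen U ∧ AnalyticOnNhd ℝ G U ∧
      ∀ z ∈ D, (∀ h, 0 ≤ (z h).im) → sqOn Finset.univ z ∈ U ∧
        H z = (∏ k ∈ K, (z k).im) • G (sqOn Finset.univ z) := by
  have hloc : ∀ z : Fin n → ℂ, z ∈ D ∧ (∀ h, 0 ≤ (z h).im) → ∃ G : (Fin n → ℂ) → F,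
      AnalyticAt ℝ G (sqOn Finset.univ z) ∧
      ∀ᶠ x in 𝓝 z, H x = (∏ k ∈ K, (x k).im) • G (sqOn Finset.univ x) := fun z hz =>
    exists_analyticAt_sqOn K (hH z hz.1) hz.2 fun k _ => by
      filter_upwards [hD.mem_nhds hz.1] with x hx using hp x hx k
  choose! Γ hΓa hΓH using hloc
  obtain ⟨U, G, hU, hSU, hGa, hG⟩ := exists_analyticOnNhd_of_germs
    (S := sqOn Finset.univ '' {z | z ∈ D ∧ ∀ h, 0 ≤ (z h).im})
    (O := {w : Fin n → ℂ | ∀ h ∈ Finset.univ, 0 < (w h).im}) (Φ := fun w => Γ (sqrtIm w))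
    (g := fun w => (∏ k ∈ K, (sqrtIm w k).im)⁻¹ • H (sqrtIm w)) (isOpen_im_pos _)
    (by
      rintro _ ⟨z, -, rfl⟩
      refine mem_closure_im_pos _ fun h _ => ?_
      simp [sqOn, sq_nonneg])
    (by
      rintro _ ⟨z, hz, rfl⟩
      rw [sqrtIm_sqOn hz.2]
      exact hΓa z hz)
    (by
      rintro _ ⟨z, hz, rfl⟩
      have h1 := continuous_sqrtIm.tendsto (sqOn Finset.univ z)
      rw [sqrtIm_sqOn hz.2] at h1 ⊢
      filter_upwards [h1.eventually (hΓH z hz)] with w hw hw0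
      rw [hw, sqOn_sqrtIm fun h => (hw0 h (Finset.mem_univ h)).le, smul_smul, inv_mul_cancel₀,
        one_smul]
      refine Finset.prod_ne_zero_iff.2 fun k _ => ?_
      exact (Real.sqrt_pos.2 (hw0 k (Finset.mem_univ k))).ne')
  refine ⟨U, G, hU, hGa, fun z hz hz0 => ⟨hSU ⟨z, ⟨hz, hz0⟩, rfl⟩, ?_⟩⟩
  rw [hG _ ⟨z, ⟨hz, hz0⟩, rfl⟩, sqrtIm_sqOn hz0]
  exact (hΓH z ⟨hz, hz0⟩).self_of_nhds

end AnalyticCoordinate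

end SliceFunctions

/-! ### Local extensions, gluing and localization -/

namespace SliceFunctions

open MeasureTheory Filter Topology Set
open scoped ContDiff Manifold

section Gluing

variable {X Y : Type*} [NormedAddCommGroup X] [NormedSpace ℝ X] [FiniteDimensional ℝ X]
  [NormedAddCommGroup Y] [NormedSpace ℝ Y]

/-- A smooth partition of unity glues local `C^r` extensions of `f`, because the extensions agree
on `S`. -/
theorem isOfClass_of_local {r : ℕ∞} {S : Set X} {f : S → Y}
    (h : ∀ x ∈ S, ∃ g : X → Y, ContDiff ℝ r g ∧ ∀ᶠ y in 𝓝 x, ∀ hy : y ∈ S, g y = f ⟨y, hy⟩) :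
    IsOfClass r f := by
  constructor
  · intro _
    refine continuous_iff_continuousAt.2 fun x => ?_
    obtain ⟨g, hg, hgf⟩ := h x x.2
    refine (hg.continuous.continuousAt.comp continuous_subtype_val.continuousAt).congr ?_
    filter_upwards [continuous_subtype_val.continuousAt.eventually hgf] with y hy using hy y.2
  · intro _
    let U : TopologicalSpace.Opens X :=
      ⟨{x | ∃ g : X → Y, ContDiff ℝ r g ∧ ∀ᶠ y in 𝓝 x, ∀ hy : y ∈ S, g y = f ⟨y, hy⟩}, by
        refine isOpen_iff_mem_nhds.2 ?_
        rintro x ⟨g, hg, hgf⟩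
        filter_upwards [eventually_eventually_nhds.2 hgf] with y hy using ⟨g, hg, hy⟩⟩
    have : ProperSpace X := FiniteDimensional.proper_real X
    have : LocallyCompactSpace U := U.isOpen.locallyCompactSpace
    obtain ⟨g, hg⟩ := exists_contMDiffMap_forall_mem_convex_of_local (M := U) (F := Y) 𝓘(ℝ, X)
      (n := r) (t := fun x => {c | ∀ hx : (x : X) ∈ S, c = f ⟨x, hx⟩})
      (fun x => by
        by_cases hx : (x : X) ∈ S
        · simp only [hx, forall_true_left, ofPred_eq_eq_singleton]
          exact convex_singleton _
        · simp only [hx, IsEmpty.forall_iff, ofPred_true]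
          exact convex_univ)
      (fun x => by
        obtain ⟨g, hg, hgf⟩ := x.2
        refine ⟨_, continuous_subtype_val.continuousAt.eventually hgf, fun y => g y, ?_,
          fun y hy => hy⟩
        intro y _
        exact (contMDiffAt_subtype_iff.2 hg.contMDiff.contMDiffAt).contMDiffWithinAt)
    classical
    let g' : X → Y := fun x => if hx : x ∈ U then g ⟨x, hx⟩ else 0
    have hg' : ∀ y : U, g' y = g y := fun y => dif_pos y.2
    refine ⟨U, g', U.isOpen, fun x hx => h x hx, ?_, ?_⟩
    · intro x hx
      have h1 : ContMDiffAt 𝓘(ℝ, X) 𝓘(ℝ, Y) r (fun y : U => g' y) ⟨x, hx⟩ := by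
        simp only [hg']
        exact g.contMDiff ⟨x, hx⟩
      have h2 : ContMDiffAt 𝓘(ℝ, X) 𝓘(ℝ, Y) r g' x :=
        contMDiffAt_subtype_iff (x := (⟨x, hx⟩ : U)).1 h1
      exact h2.contDiffAt.contDiffWithinAt
    · intro x
      exact (hg' ⟨x, h x x.2⟩).trans (hg ⟨x, h x x.2⟩ x.2)

end Gluing

section Localization

variable {n : ℕ}

theorem IsConjInvariant.ite_conj_mem {D : Set (Fin n → ℂ)} (hD : IsConjInvariant D)
    (p : Fin n → Prop) [DecidablePred p] {z : Fin n → ℂ} (hz : z ∈ D) :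
    (fun h => if p h then (starRingEnd ℂ) (z h) else z h) ∈ D := by
  have key : ∀ S : Finset (Fin n),
      (fun h => if h ∈ S ∧ p h then (starRingEnd ℂ) (z h) else z h) ∈ D := by
    intro S
    induction S using Finset.induction_on with
    | empty => simpa using hz
    | insert k S hk ih =>
      by_cases hpk : p k
      · convert hD _ ih k using 1
        funext h
        by_cases hh : h = k
        · subst hh; simp [conjAt, hk, hpk]
        · simp [conjAt, hh]
      · convert ih using 1
        funext h
        by_cases hh : h = k
        · subst hh; simp [hpk]
        · simp [hh]
  simpa using key Finset.univ

theorem contDiff_sqOn_univ {m : WithTop ℕ∞} :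
    ContDiff ℝ m (sqOn Finset.univ : (Fin n → ℂ) → Fin n → ℂ) := by
  refine contDiff_pi.2 fun k => ?_
  have h1 : (fun z : Fin n → ℂ => sqOn Finset.univ z k) = fun z =>
      Complex.ofRealCLM (Complex.reCLM (z k)) + (Complex.imCLM (z k) ^ 2) • Complex.I := by
    funext z
    apply Complex.ext <;> simp [sqOn, -Complex.ofReal_pow]
  rw [h1]
  fun_prop

theorem sqOn_conjAt (k : Fin n) (z : Fin n → ℂ) :
    sqOn Finset.univ (conjAt k z) = sqOn Finset.univ z := by
  funext h
  by_cases hh : h = k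
  · subst hh; simp [sqOn, conjAt]
  · simp [sqOn, conjAt, hh]

/-- Squares of imaginary parts close to those of `z₀` determine `z` up to conjugation of
coordinates and a small error, so invariance of `D` gives `z ∈ D`. -/
theorem exists_closedBall_sqOn_subset {D : Set (Fin n → ℂ)} (hDo : IsOpen D)
    (hD : IsConjInvariant D) {z₀ : Fin n → ℂ} (hz₀ : z₀ ∈ D) :
    ∃ ρ : ℝ, 0 < ρ ∧ ∀ z, sqOn Finset.univ z ∈ Metric.closedBall (sqOn Finset.univ z₀) ρ → z ∈ D := by
  obtain ⟨ε, hε, hball⟩ := Metric.isOpen_iff.1 hDo z₀ hz₀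
  have hρ : 0 < min (ε / 4) (ε ^ 2 / 16) := lt_min (by positivity) (by positivity)
  refine ⟨min (ε / 4) (ε ^ 2 / 16), hρ, fun z hz => ?_⟩
  have hcoord : ∀ h, |(z h).re - (z₀ h).re| ≤ ε / 4 ∧
      |(z h).im ^ 2 - (z₀ h).im ^ 2| ≤ ε ^ 2 / 16 := fun h => by
    have h1 := (dist_pi_le_iff hρ.le).1 (Metric.mem_closedBall.1 hz) h
    rw [Complex.dist_eq] at h1
    have h2 := (Complex.abs_re_le_norm _).trans h1
    have h3 := (Complex.abs_im_le_norm _).trans h1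
    simp only [sqOn, Finset.mem_univ, if_true, Complex.sub_re, Complex.sub_im] at h2 h3
    exact ⟨h2.trans (min_le_left _ _), h3.trans (min_le_right _ _)⟩
  -- after conjugating some coordinates, `z` is close to `z₀`
  classical
  let p : Fin n → Prop := fun h => ε / 4 < |(z h).im - (z₀ h).im|
  have hw : (fun h => if p h then (starRingEnd ℂ) (z h) else z h) ∈ D := by
    refine hball ?_
    rw [Metric.mem_ball, dist_pi_lt_iff hε]
    intro h
    rw [Complex.dist_eq]
    refine (Complex.norm_le_abs_re_add_abs_im _).trans_lt ?_
    obtain ⟨hre, him⟩ := hcoord h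
    by_cases hp : p h
    · have hp' : ε / 4 < |(z h).im - (z₀ h).im| := hp
      have h1 : |(z h).im + (z₀ h).im| ≤ ε / 4 := by
        by_contra! hc
        have h2 : |(z h).im ^ 2 - (z₀ h).im ^ 2| =
            |(z h).im - (z₀ h).im| * |(z h).im + (z₀ h).im| := by
          rw [← abs_mul]; ring_nf
        rw [h2] at him
        nlinarith [mul_lt_mul'' hp' hc (by positivity) (by positivity)]
      have h3 : |-(z h).im - (z₀ h).im| = |(z h).im + (z₀ h).im| := by
        rw [← abs_neg]; ring_nf
      simp only [hp, if_true, Complex.sub_re, Complex.sub_im, Complex.conj_re, Complex.conj_im, h3]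
      linarith
    · have hp' : |(z h).im - (z₀ h).im| ≤ ε / 4 := not_lt.1 hp
      simp only [hp, if_false, Complex.sub_re, Complex.sub_im]
      linarith
  convert hD.ite_conj_mem p hw using 1
  funext h
  by_cases hp : p h <;> simp [hp]

variable {F : Type*} [NormedAddCommGroup F] [NormedSpace ℝ F] [CompleteSpace F]

/-- The local form of `exists_contDiff_sqOn`: a cutoff depending only on the squares of the imaginary
parts preserves the parities. -/
theorem exists_contDiff_sqOn_local (K : Finset (Fin n)) {H : (Fin n → ℂ) → F} {r : ℕ∞}
    (hr : (2 ^ n : ℕ) ≤ r + 1) {D : Set (Fin n → ℂ)} (hDo : IsOpen D) (hD : IsConjInvariant D)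
    (hc : ContDiffOn ℝ r H D) (hp : ∀ z ∈ D, ∀ k, H (conjAt k z) = paritySign K k • H z)
    {z₀ : Fin n → ℂ} (hz₀ : z₀ ∈ D) :
    ∃ G : (Fin n → ℂ) → F,
      (∀ s : ℕ, (2 ^ n * (s + 1) : ℕ) ≤ r + 1 → ContDiff ℝ s G) ∧
      ∀ᶠ w in 𝓝 (sqOn Finset.univ z₀), ∀ z, sqOn Finset.univ z = w →
        H z = (∏ k ∈ K, (z k).im) • G w := by
  obtain ⟨ρ, hρ, hρD⟩ := exists_closedBall_sqOn_subset hDo hD hz₀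
  let b : ContDiffBump (sqOn Finset.univ z₀) := ⟨ρ / 2, ρ, half_pos hρ, half_lt_self hρ⟩
  let H' : (Fin n → ℂ) → F := fun z => b (sqOn Finset.univ z) • H z
  have hzero : ∀ z, z ∉ D → b (sqOn Finset.univ z) = 0 := fun z hz =>
    b.zero_of_le_dist (not_lt.1 fun h => hz (hρD z (Metric.mem_closedBall.2 h.le)))
  have hH'c : ContDiff ℝ r H' := by
    refine contDiff_iff_contDiffAt.2 fun z => ?_
    by_cases hz : z ∈ D
    · exact (b.contDiff.comp contDiff_sqOn_univ).contDiffAt.smul (hc.contDiffAt (hDo.mem_nhds hz))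
    · have hev : H' =ᶠ[𝓝 z] fun _ => 0 := by
        have ho : IsOpen {z : Fin n → ℂ | ρ < dist (sqOn Finset.univ z) (sqOn Finset.univ z₀)} :=
          isOpen_lt continuous_const ((continuous_sqOn _).dist continuous_const)
        have hzm : ρ < dist (sqOn Finset.univ z) (sqOn Finset.univ z₀) :=
          not_le.1 fun h => hz (hρD z (Metric.mem_closedBall.2 h))
        filter_upwards [ho.mem_nhds hzm] with y hy
        have : b (sqOn Finset.univ y) = 0 := b.zero_of_le_dist (le_of_lt hy)
        simp [H', this]
      exact contDiffAt_const.congr_of_eventuallyEq hev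
  have hH's : ∃ R : ℝ, ∀ k z, R < |(z k).im| → H' z = 0 := by
    refine ⟨max 1 (‖sqOn Finset.univ z₀‖ + ρ), fun k z hz => ?_⟩
    have h1 : b (sqOn Finset.univ z) = 0 := by
      refine b.zero_of_le_dist ?_
      change ρ ≤ _
      have h2 : (z k).im ^ 2 ≤ ‖sqOn Finset.univ z‖ := by
        refine le_trans ?_ (norm_le_pi_norm _ k)
        refine le_trans ?_ (Complex.abs_im_le_norm _)
        simp [sqOn]
      have h3 := norm_sub_norm_le (sqOn Finset.univ z) (sqOn Finset.univ z₀)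
      rw [dist_eq_norm]
      have h4 := (le_max_left _ _).trans_lt hz
      have h5 := (le_max_right _ _).trans_lt hz
      have h6 : |(z k).im| ≤ (z k).im ^ 2 := by
        rw [← sq_abs]; nlinarith
      linarith
    simp [H', h1]
  have hH'p : ∀ k z, H' (conjAt k z) = paritySign K k • H' z := by
    intro k z
    by_cases hz : z ∈ D
    · simp only [H', sqOn_conjAt, hp z hz k]
      rw [smul_comm]
    · simp [H', sqOn_conjAt, hzero z hz]
  obtain ⟨G, hGc, hG⟩ := exists_contDiff_sqOn K hr hH'c hH's hH'p
  refine ⟨G, hGc, ?_⟩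
  filter_upwards [b.eventuallyEq_one] with w hw z hzw
  rw [← hzw, ← hG z]
  have : b (sqOn Finset.univ z) = 1 := by rw [hzw]; exact hw
  simp [H', this]

end Localization

end SliceFunctions

/-! ### Slice functions -/

namespace SliceFunctions

open MeasureTheory Filter Topology Set
open scoped ContDiff TensorProduct

section OrderedProduct

variable {n : ℕ} {A : Type*} [NormedNonAssocRing A] [NormedSpace ℝ A]
  [IsScalarTower ℝ A A] [SMulCommClass ℝ A A]

theorem orderedProduct_smul (K : Finset (Fin n)) (c : Fin n → ℝ) (J : Fin n → A) (v : A) :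
    orderedProduct (fun h => c h • J h) K v = (∏ k ∈ K, c k) • orderedProduct J K v := by
  have key : ∀ l : List (Fin n), l.foldr (fun k a => (c k • J k) * a) v =
      (l.map c).prod • l.foldr (fun k a => J k * a) v := by
    intro l
    induction l with
    | nil => simp
    | cons k l ih =>
      simp only [List.foldr_cons, List.map_cons, List.prod_cons, ih]
      rw [smul_mul_assoc, mul_smul_comm, smul_smul]
  have hprod : ∏ k ∈ K, c k = ((K.sort (· ≤ ·)).map c).prod := by
    rw [← Multiset.prod_coe, ← Multiset.map_coe, Finset.sort_eq]
    rfl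
  rw [hprod]
  exact key _

omit [IsScalarTower ℝ A A] in
theorem orderedProduct_const_smul (K : Finset (Fin n)) (c : ℝ) (J : Fin n → A) (v : A) :
    orderedProduct J K (c • v) = c • orderedProduct J K v := by
  unfold orderedProduct
  induction K.sort (· ≤ ·) with
  | nil => rfl
  | cons k l ih => simp only [List.foldr_cons, ih, mul_smul_comm]

variable [FiniteDimensional ℝ A]

theorem contDiff_mul_nonAssoc {m : WithTop ℕ∞} : ContDiff ℝ m fun p : A × A => p.1 * p.2 := by
  let μ : A →L[ℝ] A →L[ℝ] A := LinearMap.toContinuousLinearMap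
    ((LinearMap.toContinuousLinearMap : (A →ₗ[ℝ] A) ≃ₗ[ℝ] A →L[ℝ] A).toLinearMap.comp
      (LinearMap.mul ℝ A))
  have h1 : (fun p : A × A => p.1 * p.2) = fun p => μ p.1 p.2 := rfl
  rw [h1]
  fun_prop

theorem contDiffAt_orderedProduct {X : Type*} [NormedAddCommGroup X] [NormedSpace ℝ X]
    {m : WithTop ℕ∞} {u : X → Fin n → A} {v : X → A} {x : X} (K : Finset (Fin n))
    (hu : ContDiffAt ℝ m u x) (hv : ContDiffAt ℝ m v x) :
    ContDiffAt ℝ m (fun y => orderedProduct (u y) K (v y)) x := by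
  unfold orderedProduct
  induction K.sort (· ≤ ·) with
  | nil => exact hv
  | cons k l ih =>
    simp only [List.foldr_cons]
    exact contDiff_mul_nonAssoc.contDiffAt.comp x ((contDiffAt_pi.1 hu k).prodMk ih)

theorem continuous_orderedProduct (K : Finset (Fin n)) :
    Continuous fun p : (Fin n → A) × A => orderedProduct p.1 K p.2 := by
  refine ContDiff.continuous (𝕜 := ℝ) (n := 0) (contDiff_iff_contDiffAt.2 fun p => ?_)
  exact contDiffAt_orderedProduct K contDiffAt_fst contDiffAt_snd

end OrderedProduct

section SliceCoordinates

variable {n : ℕ} {A : Type*} [NormedNonAssocRing A] [NormedSpace ℝ A]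
  [StarRing A] [StarModule ℝ A]

/-- If `x` is represented by `z` and `φ 1 = 1`, then `sliceCoord φ x` has the coordinates
`((z h).re, (z h).im ^ 2)`, as `x + x^c = 2 (z h).re` and `x x^c = |z h|²`. -/
noncomputable def sliceCoord (φ : A →L[ℝ] ℝ) (x : Fin n → A) : Fin n → ℂ := fun h =>
  ⟨φ (x h + star (x h)) / 2, φ (x h * star (x h)) - (φ (x h + star (x h)) / 2) ^ 2⟩

/-- The slice function of the stem function with components `z ↦ (∏ k ∈ K, (z k).im) • G K (z²)`,
where `z²` stands for `sqOn Finset.univ z`, written without reference to imaginary units. -/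
noncomputable def sliceExtension (φ : A →L[ℝ] ℝ) (G : Finset (Fin n) → (Fin n → ℂ) → A)
    (x : Fin n → A) : A :=
  ∑ K, orderedProduct (fun h => x h - (sliceCoord φ x h).re • (1 : A)) K (G K (sliceCoord φ x))

variable [IsScalarTower ℝ A A] [SMulCommClass ℝ A A]

theorem sliceCoord_eq {φ : A →L[ℝ] ℝ} (hφ : φ 1 = 1) {z : Fin n → ℂ} {J x : Fin n → A}
    (h : Represents z J x) : sliceCoord φ x = sqOn Finset.univ z := by
  funext k
  have hJ := (h.1 k).1
  have hJ1 := (h.1 k).2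
  have hs : star (J k) = -J k := by
    rw [eq_neg_iff_add_eq_zero, add_comm]; exact hJ
  rw [hs, mul_neg] at hJ1
  have hx := h.2 k
  have hxs : star (x k) = (z k).re • (1 : A) - (z k).im • J k := by
    rw [hx, star_add, star_smul, star_smul, star_one, hs]
    simp [sub_eq_add_neg]
  have h1 : x k + star (x k) = (2 * (z k).re) • (1 : A) := by
    rw [hxs, hx, two_mul, add_smul]; abel
  have h2 : x k * star (x k) = ((z k).re ^ 2 + (z k).im ^ 2) • (1 : A) := by
    have hJJ : J k * J k = -1 := by rw [← hJ1, neg_neg]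
    rw [hxs, hx]
    simp only [add_mul, mul_sub, smul_mul_assoc, mul_smul_comm, one_mul, mul_one, hJJ]
    module
  have h3 : φ (x k + star (x k)) / 2 = (z k).re := by
    rw [h1, map_smul, hφ]; simp
  have h4 : φ (x k * star (x k)) = (z k).re ^ 2 + (z k).im ^ 2 := by
    rw [h2, map_smul, hφ]; simp
  apply Complex.ext
  · simp only [sliceCoord, sqOn, h3, Finset.mem_univ, if_true]
  · simp only [sliceCoord, sqOn, h3, h4, Finset.mem_univ, if_true]
    ring

/-- At a point represented by `z` and `J`, the coordinate `x k - re • 1` is `(z k).im • J k`; the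
ordered product then pulls out exactly the factor `∏ k ∈ K, (z k).im`. -/
theorem sliceExtension_eq {φ : A →L[ℝ] ℝ} (hφ : φ 1 = 1) {z : Fin n → ℂ} {J x : Fin n → A}
    (h : Represents z J x) (G : Finset (Fin n) → (Fin n → ℂ) → A) :
    sliceExtension φ G x =
      ∑ K, orderedProduct J K ((∏ k ∈ K, (z k).im) • G K (sqOn Finset.univ z)) := by
  have hu : (fun k => x k - (sliceCoord φ x k).re • (1 : A)) = fun k => (z k).im • J k := by
    funext k
    rw [sliceCoord_eq hφ h, h.2 k]
    simp [sqOn]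
  simp only [sliceExtension, hu]
  refine Finset.sum_congr rfl fun K _ => ?_
  rw [orderedProduct_smul, orderedProduct_const_smul, sliceCoord_eq hφ h]

variable [FiniteDimensional ℝ A]

theorem contDiff_sliceCoord (φ : A →L[ℝ] ℝ) {m : WithTop ℕ∞} :
    ContDiff ℝ m (sliceCoord φ : (Fin n → A) → Fin n → ℂ) := by
  let σ : A →L[ℝ] A := LinearMap.toContinuousLinearMap
    { toFun := star, map_add' := star_add, map_smul' := fun c x => by simp [star_smul] }
  have hσ : ∀ x, σ x = star x := fun _ => rfl
  refine contDiff_pi.2 fun h => ?_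
  have hx : ContDiff ℝ m fun x : Fin n → A => x h := contDiff_apply ℝ A h
  have h1 : ContDiff ℝ m fun x : Fin n → A => φ (x h + σ (x h)) / 2 := by fun_prop
  have h2 : ContDiff ℝ m fun x : Fin n → A => φ (x h * σ (x h)) :=
    φ.contDiff.comp (contDiff_mul_nonAssoc.comp (hx.prodMk (σ.contDiff.comp hx)))
  have h3 : (fun x : Fin n → A => sliceCoord φ x h) = fun x =>
      Complex.ofRealCLM (φ (x h + σ (x h)) / 2) +
        (φ (x h * σ (x h)) - (φ (x h + σ (x h)) / 2) ^ 2) • Complex.I := by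
    funext x
    apply Complex.ext <;>
      simp [sliceCoord, hσ, -map_add, -Complex.ofReal_pow, -Complex.ofReal_sub, -Complex.ofReal_div]
  rw [h3]
  exact (Complex.ofRealCLM.contDiff.comp h1).add ((h2.sub (h1.pow 2)).smul contDiff_const)

theorem contDiffAt_sliceExtension (φ : A →L[ℝ] ℝ) {G : Finset (Fin n) → (Fin n → ℂ) → A}
    {m : WithTop ℕ∞} {x : Fin n → A} (hG : ∀ K, ContDiffAt ℝ m (G K) (sliceCoord φ x)) :
    ContDiffAt ℝ m (sliceExtension φ G) x := by
  have hs : ContDiff ℝ m (sliceCoord φ : (Fin n → A) → Fin n → ℂ) := contDiff_sliceCoord φ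
  refine ContDiffAt.sum fun K _ => contDiffAt_orderedProduct K ?_ ?_
  · refine ContDiff.contDiffAt (contDiff_pi.2 fun h => (contDiff_apply ℝ A h).sub ?_)
    exact (Complex.reCLM.contDiff.comp (contDiff_pi.1 hs h)).smul contDiff_const
  · exact (hG K).comp x hs.contDiffAt

omit [IsScalarTower ℝ A A] [SMulCommClass ℝ A A] [FiniteDimensional ℝ A] [StarModule ℝ A] in
/-- A point of the circularization is represented by a point whose coordinates have nonnegative
imaginary part, because `(α, β, J)` and `(α, -β, -J)` give the same point. -/
theorem exists_represents_nonneg {D : Set (Fin n → ℂ)} (hD : IsConjInvariant D) {x : Fin n → A}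
    (hx : x ∈ circularization A D) :
    ∃ z ∈ D, (∀ h, 0 ≤ (z h).im) ∧ ∃ J : Fin n → A, Represents z J x := by
  obtain ⟨z, hz, J, hJ⟩ := hx
  refine ⟨_, hD.ite_conj_mem (fun h => (z h).im < 0) hz, fun h => ?_,
    fun h => if (z h).im < 0 then -J h else J h, fun h => ?_, fun h => ?_⟩
  · by_cases hh : (z h).im < 0
    · simp [hh, hh.le]
    · simpa [hh] using not_lt.1 hh
  · by_cases hh : (z h).im < 0
    · have h1 := hJ.1 h
      simp only [imaginaryUnits, mem_ofPred_eq] at h1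
      simp only [hh, if_true, imaginaryUnits, mem_ofPred_eq, star_neg, neg_mul_neg, h1.2, and_true]
      rw [← neg_add, h1.1, neg_zero]
    · simpa [hh] using hJ.1 h
  · by_cases hh : (z h).im < 0 <;> simp [hh, hJ.2 h]

end SliceCoordinates

section Main

variable {n : ℕ} {A : Type*} [NormedNonAssocRing A] [NormedSpace ℝ A]
  [IsScalarTower ℝ A A] [SMulCommClass ℝ A A] [FiniteDimensional ℝ A]
  [StarRing A] [StarModule ℝ A]
  {e : Module.Basis (Finset (Fin n)) ℝ (Fin (2 ^ n) → ℝ)} {D : Set (Fin n → ℂ)}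

theorem continuous_of_mem_sliceClass {φ : A →L[ℝ] ℝ} (hφ : φ 1 = 1) (hD : IsConjInvariant D)
    (hc : IsCompact (imaginaryUnits A)) {f : circularization A D → A}
    (hf : f ∈ sliceClass A e D 0) : Continuous f := by
  obtain ⟨F, -, hFc, hF⟩ := hf
  have hex : ∀ x : circularization A D, ∃ z ∈ D, (∀ h, 0 ≤ (z h).im) ∧
      ∃ J : Fin n → A, Represents z J (x : Fin n → A) := fun x => exists_represents_nonneg hD x.2
  choose z hzD hz0 J hJ using hex
  -- the normalized representative `z x` depends continuously on `x`
  have hzc : Continuous z := by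
    have h1 : z = fun x : circularization A D => sqrtIm (sliceCoord φ (x : Fin n → A)) := by
      funext x
      rw [sliceCoord_eq hφ (hJ x), sqrtIm_sqOn (hz0 x)]
    rw [h1]
    exact continuous_sqrtIm.comp
      ((contDiff_sliceCoord (n := n) φ (m := 0)).continuous.comp continuous_subtype_val)
  refine continuous_iff_continuousAt.2 fun x => tendsto_iff_ultrafilter _ _ _ |>.2 fun 𝒰 h𝒰 => ?_
  have hcpt : IsCompact (univ.pi fun _ : Fin n => imaginaryUnits A) :=
    isCompact_univ_pi fun _ => hc
  obtain ⟨J', hJ'mem, hJ'⟩ := hcpt.ultrafilter_le_nhds (𝒰.map J) (by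
    rw [le_principal_iff, Ultrafilter.mem_coe, Ultrafilter.mem_map]
    exact univ_mem' fun y h _ => (hJ y).1 h)
  have hJlim : Tendsto J 𝒰 (𝓝 J') := hJ'
  have hzlim : Tendsto z 𝒰 (𝓝 (z x)) := (hzc.tendsto x).mono_left h𝒰
  have hrep : Represents (z x) J' (x : Fin n → A) := by
    refine ⟨fun h => hJ'mem h (mem_univ h), fun h => ?_⟩
    have h1 : Tendsto (fun y : circularization A D => (y : Fin n → A) h) 𝒰
        (𝓝 ((x : Fin n → A) h)) :=
      (((continuous_apply h).comp continuous_subtype_val).tendsto x).mono_left h𝒰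
    have hzh := tendsto_pi_nhds.1 hzlim h
    have h2 : Tendsto (fun y => (z y h).re • (1 : A) + (z y h).im • J y h) 𝒰
        (𝓝 ((z x h).re • (1 : A) + (z x h).im • J' h)) :=
      (((Complex.continuous_re.tendsto _).comp hzh).smul_const _).add
        (((Complex.continuous_im.tendsto _).comp hzh).smul (tendsto_pi_nhds.1 hJlim h))
    have h3 : (fun y : circularization A D => (y : Fin n → A) h) =
        fun y => (z y h).re • (1 : A) + (z y h).im • J y h := funext fun y => (hJ y).2 h
    rw [h3] at h1
    exact tendsto_nhds_unique h1 h2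
  have hfx : f = fun y => ∑ K, orderedProduct (J y) K (component e F K ⟨z y, hzD y⟩) :=
    funext fun y => hF y ⟨z y, hzD y⟩ (J y) (hJ y)
  rw [hF x ⟨z x, hzD x⟩ J' hrep, hfx]
  refine tendsto_finsetSum _ fun K _ => ?_
  have h1 : Tendsto (fun y => component e F K ⟨z y, hzD y⟩) 𝒰
      (𝓝 (component e F K ⟨z x, hzD x⟩)) :=
    ((((hFc K).1 rfl).comp (hzc.subtype_mk hzD)).tendsto x).mono_left h𝒰
  exact ((continuous_orderedProduct K).tendsto _).comp (hJlim.prodMk_nhds h1)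

omit [IsScalarTower ℝ A A] [SMulCommClass ℝ A A] [FiniteDimensional ℝ A] in
omit [StarRing A] [StarModule ℝ A] in
/-- The components of a stem function of class `C^r` on an open set are restrictions of functions
on `ℂⁿ` with the same parities. -/
theorem exists_contDiffOn_component {r : WithTop ℕ∞} (hr : r ≠ 0) (hD : IsConjInvariant D)
    {F : D → A ⊗[ℝ] (Fin (2 ^ n) → ℝ)} (hF : IsStem e F)
    (hFc : ∀ K, IsOfClass r (component e F K)) :
    ∃ H : Finset (Fin n) → (Fin n → ℂ) → A, ∀ K, ContDiffOn ℝ r (H K) D ∧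
      (∀ z : D, H K z = component e F K z) ∧
      ∀ z ∈ D, ∀ k, H K (conjAt k z) = paritySign K k • H K z := by
  choose U H _ hDU hH hHF using fun K => (hFc K).2 hr
  refine ⟨H, fun K => ⟨(hH K).mono (hDU K), hHF K, fun z hz k => ?_⟩⟩
  have h1 := hF K k ⟨z, hz⟩ ⟨conjAt k z, hD z hz k⟩ rfl
  rw [← hHF K, ← hHF K] at h1
  unfold paritySign
  split_ifs with hk
  · rw [neg_one_smul]; exact h1.2 hk
  · rw [one_smul]; exact h1.1 hk

theorem isOfClass_of_mem_sliceClass {φ : A →L[ℝ] ℝ} (hφ : φ 1 = 1) (hD : IsConjInvariant D)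
    (hDo : IsOpen D) {r w : ℕ∞} (hr0 : r ≠ 0) (hr : (2 ^ n : ℕ) ≤ r + 1)
    (hw : ∀ s : ℕ, (s : ℕ∞) ≤ w → (2 ^ n * (s + 1) : ℕ) ≤ r + 1)
    {f : circularization A D → A} (hf : f ∈ sliceClass A e D r) : IsOfClass w f := by
  have : CompleteSpace A := FiniteDimensional.complete ℝ A
  obtain ⟨F, hFs, hFc, hF⟩ := hf
  obtain ⟨H, hH⟩ := exists_contDiffOn_component (by exact_mod_cast hr0) hD hFs hFc
  refine isOfClass_of_local fun x hx => ?_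
  obtain ⟨z, hz, J, hJ⟩ := hx
  choose G hGc hG using fun K =>
    exists_contDiff_sqOn_local K hr hDo hD (hH K).1 (hH K).2.2 hz
  refine ⟨sliceExtension φ G, contDiff_iff_contDiffAt.2 fun y =>
    contDiffAt_sliceExtension φ fun K => ContDiff.contDiffAt ?_, ?_⟩
  · exact contDiff_iff_forall_nat_le.2 fun s hs => hGc K s (hw s hs)
  · have h1 := (contDiff_sliceCoord (n := n) φ (m := 0)).continuous.tendsto x
    rw [sliceCoord_eq hφ hJ] at h1
    filter_upwards [h1.eventually (eventually_all.2 hG)] with y hy hyΩ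
    obtain ⟨z', hz', J', hJ'⟩ := id hyΩ
    rw [hF ⟨y, hyΩ⟩ ⟨z', hz'⟩ J' hJ', sliceExtension_eq hφ hJ']
    refine Finset.sum_congr rfl fun K _ => ?_
    have h2 := hy K z' (sliceCoord_eq hφ hJ').symm
    rw [sliceCoord_eq hφ hJ'] at h2
    rw [← h2, (hH K).2.1 ⟨z', hz'⟩]

theorem isOfClass_omega_of_mem_sliceClass {φ : A →L[ℝ] ℝ} (hφ : φ 1 = 1) (hD : IsConjInvariant D)
    (hDo : IsOpen D) {f : circularization A D → A} (hf : f ∈ sliceClass A e D ω) :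
    IsOfClass ω f := by
  have : CompleteSpace A := FiniteDimensional.complete ℝ A
  obtain ⟨F, hFs, hFc, hF⟩ := hf
  obtain ⟨H, hH⟩ := exists_contDiffOn_component (by simp) hD hFs hFc
  choose U G hUo hGa hG using fun K => exists_analyticOnNhd_sqOn K hDo
    (fun z hz => ((hH K).1.contDiffAt (hDo.mem_nhds hz)).analyticAt) (hH K).2.2
  have hs := (contDiff_sliceCoord (A := A) (n := n) φ (m := 0)).continuous
  refine ⟨fun h => by simp at h, fun _ => ⟨sliceCoord φ ⁻¹' ⋂ K, U K, sliceExtension φ G,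
    (isOpen_iInter_of_finite hUo).preimage hs, fun x hx => ?_, fun x hx => ?_, fun x => ?_⟩⟩
  · obtain ⟨z, hz, hz0, J, hJ⟩ := exists_represents_nonneg hD hx
    rw [mem_preimage, sliceCoord_eq hφ hJ]
    exact mem_iInter.2 fun K => (hG K z hz hz0).1
  · exact (contDiffAt_sliceExtension φ fun K =>
      (hGa K _ (mem_iInter.1 hx K)).contDiffAt).contDiffWithinAt
  · obtain ⟨z, hz, hz0, J, hJ⟩ := exists_represents_nonneg hD x.2
    rw [hF x ⟨z, hz⟩ J hJ, sliceExtension_eq hφ hJ]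
    refine Finset.sum_congr rfl fun K _ => ?_
    rw [← (hG K z hz hz0).2, (hH K).2.1 ⟨z, hz⟩]

end Main

end SliceFunctions

theorem mainTheorem7 {A : Type*} [SliceFunctions.NormedNonAssocRing A] [NormedSpace ℝ A]
    [IsScalarTower ℝ A A] [SMulCommClass ℝ A A] [FiniteDimensional ℝ A] [Nontrivial A]
    [StarRing A] [StarModule ℝ A] (hA : SliceFunctions.IsAlternative A)
    (hS : (SliceFunctions.imaginaryUnits A).Nonempty)
    (n : ℕ) (hn : 1 ≤ n) (e : Module.Basis (Finset (Fin n)) ℝ (Fin (2 ^ n) → ℝ))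
    (D : Set (Fin n → ℂ)) (hD : D.Nonempty) (hDconj : SliceFunctions.IsConjInvariant D) :
    (IsCompact (SliceFunctions.imaginaryUnits A) →
      ∀ f ∈ SliceFunctions.sliceClass A e D 0, Continuous f) ∧
    (IsOpen D →
      (∀ r : ℕ, 2 ^ n - 1 ≤ r → ∀ f ∈ SliceFunctions.sliceClass A e D (r : WithTop ℕ∞),
        SliceFunctions.IsOfClass (((r + 1) / 2 ^ n - 1 : ℕ) : WithTop ℕ∞) f) ∧
      (∀ f ∈ SliceFunctions.sliceClass A e D ∞, SliceFunctions.IsOfClass ∞ f) ∧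
      (∀ f ∈ SliceFunctions.sliceClass A e D ω, SliceFunctions.IsOfClass ω f)) := by
  obtain ⟨φ, hφ⟩ := SeparatingDual.exists_eq_one (R := ℝ) (one_ne_zero (α := A))
  refine ⟨fun hc f hf => SliceFunctions.continuous_of_mem_sliceClass hφ hDconj hc hf,
    fun hDo => ⟨fun r hr f hf => ?_, fun f hf => ?_, fun f hf =>
      SliceFunctions.isOfClass_omega_of_mem_sliceClass hφ hDconj hDo hf⟩⟩
  · have h2 : 2 ≤ 2 ^ n := by
      calc 2 = 2 ^ 1 := rfl
        _ ≤ 2 ^ n := Nat.pow_le_pow_right two_pos hn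
    have hr' : 2 ^ n ≤ r + 1 := by omega
    have hq : 1 ≤ (r + 1) / 2 ^ n := (Nat.one_le_div_iff (by positivity)).2 hr'
    refine SliceFunctions.isOfClass_of_mem_sliceClass (r := r)
      (w := (((r + 1) / 2 ^ n - 1 : ℕ) : ℕ∞)) hφ hDconj hDo ?_ ?_ (fun s hs => ?_) hf
    · have : r ≠ 0 := by omega
      exact_mod_cast this
    · exact_mod_cast hr'
    · have hs' : s ≤ (r + 1) / 2 ^ n - 1 := by exact_mod_cast hs
      have h3 : 2 ^ n * (s + 1) ≤ r + 1 :=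
        (Nat.mul_le_mul_left _ (by omega)).trans (Nat.mul_div_le (r + 1) (2 ^ n))
      exact_mod_cast h3
  · exact SliceFunctions.isOfClass_of_mem_sliceClass (r := ⊤) (w := ⊤) hφ hDconj hDo
      (by simp) (by simp) (fun s _ => by simp) hf
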